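/- Let $\mathcal X$ be a separable topological space carrying a group structure (so that differences $x-x'$ make sense), with its Borel $\sigma$-algebra. Let $g:\mathcal X\times\mathcal X\to\mathbb R$ be a continuous, positive definite (symmetric with $\sum_{a,b}c_ac_b\,g(x_a,x_b)\ge 0$), translation invariant ($g(x,x')=\Psi(x-x')$ for some $\Psi$) and bounded ($\sup_x g(x,x)<\infty$) kernel, with RKHS $\mathcal H$ and feature map $\phi(x)=g(x,\cdot)$. Assume that $g$ is characteristic: the kernel mean embedding $\nu\mapsto\mu_\nu=\mathbb E_{X\sim\nu}[\phi(X)]\in\mathcal H$ (Bochner integral) is injective on probability distributions. Put $\bar g=\sup_{x,y}g(x,y)$ and $\tilde g=\sup_{x,y}g(x,y)-\inf_{x,y}g(x,y)$. Let $N\ge 2$ and let $\nu_1,\dots,\nu_N$ be probability distributions on $\mathcal X$ (the arms), with embeddings $\mu_i=\mu_{\nu_i}$ and variances $V_i=\mathbb E_{X\sim\nu_i}\|\phi(X)-\mu_i\|^2$. The true partition of $[N]=\{1,\dots,N\}$ puts $i$ and $j$ in the same group if and only if $\mu_i=\mu_j$; let $K$ be its number of groups, which is known to the learner. All samples drawn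 below are independent, a sample of arm $i$ having distribution $\nu_i$. For $n\ge 2$ and $\delta'>0$, the procedure $\mathrm{CLUSTER}(n,\delta')$ draws $n$ fresh samples $X^i_1,\dots,X^i_n$ of every arm $i$ and computes $$\hat\mu_i=\frac1n\sum_{t=1}^n\phi(X^i_t),\qquad \|\hat\mu_j-\hat\mu_i\|^2=\frac1{n^2}\sum_{s,t=1}^n\bigl(g(X^i_s,X^i_t)-2g(X^i_s,X^j_t)+g(X^j_s,X^j_t)\bigr),$$ $$\hat V_i=\frac1{n-1}\sum_{t=1}^n\Bigl(g(X^i_t,X^i_t)-\frac1n\sum_{s=1}^n g(X^i_t,X^i_s)\Bigr),$$ $$\mathcal B^{i,j}(n,\delta')=\Bigl(\sqrt{\hat V_i}+\sqrt{\hat V_j}\Bigr)\sqrt{\frac{2\log\frac{8(N^2-N)}{\delta'}}{n}}+\frac{32}{3}\sqrt{\tilde g}\,\frac{\log\frac{8(N^2-N)}{\delta'}}{n},$$ and returns the partition of $[N]$ into the connected components of the graph that has an edge $\{i,j\}$, $i\ne j$, whenever $\|\hat\mu_j-\hat\mu_i\|\le\mathcal B^{i,j}(n,\delta')$. For $\delta\in(0,1]$,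 the algorithm $\mathrm{KABC}(\delta,K)$ runs, for $k=1,2,\dots$, $\mathrm{CLUSTER}(n_k,\delta_k)$ with $$\delta_k=\frac{\delta}{4k^2},\qquad n_k=\Bigl\lceil 2^k\log\frac{8(N^2-N)}{\delta_k}\Bigr\rceil,$$ and at the first $k$ for which the returned partition $\mathcal C_k$ has exactly $K$ groups, it stops and outputs $\mathcal C_k$. Let $\tau$ be its total number of samples, that is, the sum of $N n_k$ over the iterations performed. Define $$s_*^2=\min_{i\ne j,\ \mu_i\ne\mu_j}\left(\frac{\|\mu_i-\mu_j\|^2}{V_i\vee V_j}\wedge\frac{2\|\mu_i-\mu_j\|}{\sqrt{\bar g}}\right),\qquad k_*=\Bigl\lceil\log_2\frac{128}{s_*^2}\Bigr\rceil\vee 1,$$ where $a/0=+\infty$ for $a>0$; if $K=1$ then $s_*^2=+\infty$, $128/s_*^2=0$ and $k_*=1$. (If $K\ge2$ then $s_*^2\le 4$, so the maximum with $1$ has no effect.) **Theorem.** For every $\delta\in(0,1]$ and every such environment: 1. with probability at least $1-\delta$, $\mathrm{KABC}(\delta,K)$ terminates and outputs the true partition; 2. $\mathrm{KABC}(\delta,K)$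 terminates almost surely; 3. with probability at least $1-\delta$, $$\tau\le 8N\left(\frac{128}{s_*^2}\vee1\right)\log\left(\frac{32(N^2-N)k_*^2}{\delta}\right).$$ -/

import Mathlib

open MeasureTheory ProbabilityTheory
open scoped ENNReal

noncomputable section

namespace KABC

/-! ### Kernel and RKHS quantities -/

section Kernel

variable {𝒳 : Type*}

/-- `g` is bounded: `sup_x g(x,x) < ∞`. -/
def IsBoundedKernel (g : 𝒳 → 𝒳 → ℝ) : Prop :=
  BddAbove (Set.range fun x => g x x)

/-- `g` is translation invariant: `g(x,x') = Ψ(x - x')` for some function `Ψ`. -/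
def IsTranslationInvariant [AddGroup 𝒳] (g : 𝒳 → 𝒳 → ℝ) : Prop :=
  ∃ Ψ : 𝒳 → ℝ, ∀ x x', g x x' = Ψ (x - x')

/-- `ḡ = sup_{x,y} g(x,y)`. -/
def kernelSup (g : 𝒳 → 𝒳 → ℝ) : ℝ :=
  ⨆ p : 𝒳 × 𝒳, g p.1 p.2

/-- `g̃ = sup_{x,y} g(x,y) - inf_{x,y} g(x,y)`. -/
def kernelRange (g : 𝒳 → 𝒳 → ℝ) : ℝ :=
  (⨆ p : 𝒳 × 𝒳, g p.1 p.2) - ⨅ p : 𝒳 × 𝒳, g p.1 p.2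

variable (H : Type*) [NormedAddCommGroup H] [InnerProductSpace ℝ H] [CompleteSpace H]
  [RKHS ℝ H 𝒳 ℝ]

/-- The canonical feature map of the RKHS `H`; as a function on `𝒳`, `φ(x)` is `g(x, ·)`. -/
def featureMap (x : 𝒳) : H := RKHS.kerFun H x (1 : ℝ)

/-- The RKHS `H` (a Hilbert space of real functions on `𝒳`) has reproducing kernel `g`. -/
def HasKernel (g : 𝒳 → 𝒳 → ℝ) : Prop :=
  ∀ x y, RKHS.kernel H x y (1 : ℝ) = g x y

variable [MeasurableSpace 𝒳]

/-- The kernel mean embedding `μ_ν = E_{X ∼ ν} φ(X)`, a Bochner integral in `H`. -/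
def kme (ν : Measure 𝒳) : H := ∫ x, featureMap H x ∂ν

/-- The kernel of `H` is characteristic: on probability distributions, `ν ↦ μ_ν` is injective. -/
def IsCharacteristic : Prop :=
  Function.Injective fun ν : ProbabilityMeasure 𝒳 => kme H (ν : Measure 𝒳)

/-- The RKHS variance `E_{X ∼ ν} ‖φ(X) - μ_ν‖²`. -/
def rkhsVar (ν : Measure 𝒳) : ℝ := ∫ x, ‖featureMap H x - kme H ν‖ ^ 2 ∂ν

end Kernel

/-! ### Clusterings -/

/-- The number of (nonempty) groups of a partition of the arms, given as an equivalence
relation. -/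
def numClusters {N : ℕ} (C : Setoid (Fin N)) : ℕ := Nat.card (Quotient C)

/-- The true partition: two arms are in the same group iff their kernel mean embeddings agree. -/
def trueClustering {𝒳 : Type*} [MeasurableSpace 𝒳] (H : Type*) [NormedAddCommGroup H]
    [InnerProductSpace ℝ H] [CompleteSpace H] [RKHS ℝ H 𝒳 ℝ] {N : ℕ}
    (ν : Fin N → ProbabilityMeasure 𝒳) : Setoid (Fin N) :=
  Setoid.ker fun i => kme H (ν i : Measure 𝒳)

/-- The signal-to-noise ratio `s_*²`, as an element of `[0, ∞]`: a quotient `a / 0` with `a > 0`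
is `∞`, and so is the minimum over the empty set. -/
def snrSq {𝒳 : Type*} [MeasurableSpace 𝒳] (g : 𝒳 → 𝒳 → ℝ) (H : Type*) [NormedAddCommGroup H]
    [InnerProductSpace ℝ H] [CompleteSpace H] [RKHS ℝ H 𝒳 ℝ] {N : ℕ}
    (ν : Fin N → ProbabilityMeasure 𝒳) : ℝ≥0∞ :=
  ⨅ (i : Fin N) (j : Fin N) (_ : i ≠ j ∧ kme H (ν i : Measure 𝒳) ≠ kme H (ν j : Measure 𝒳)),
    min
      (ENNReal.ofReal (‖kme H (ν i : Measure 𝒳) - kme H (ν j : Measure 𝒳)‖ ^ 2) /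
        ENNReal.ofReal (max (rkhsVar H (ν i : Measure 𝒳)) (rkhsVar H (ν j : Measure 𝒳))))
      (ENNReal.ofReal (2 * ‖kme H (ν i : Measure 𝒳) - kme H (ν j : Measure 𝒳)‖) /
        ENNReal.ofReal (Real.sqrt (kernelSup g)))

/-- `128 / s²` as a real number (it is `0` for `s² = ∞`). -/
def invSnr (s : ℝ≥0∞) : ℝ := (128 / s).toReal

/-- `k_* = ⌈log₂ (128 / s²)⌉ ∨ 1`. The maximum with `1` matters only if all arms share the same
embedding (`s² = ∞`). -/
def kStar (s : ℝ≥0∞) : ℤ := max ⌈Real.logb 2 (invSnr s)⌉ 1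

/-! ### The statistics of the two-sample tests -/

section Algorithm

variable {𝒳 : Type*} (g : 𝒳 → 𝒳 → ℝ)

/-- The empirical MMD `‖μ̂_j - μ̂_i‖` of two samples of size `n`, computed from the kernel. -/
def empMMD {n : ℕ} (x y : Fin n → 𝒳) : ℝ :=
  Real.sqrt (1 / (n : ℝ) ^ 2 *
    ∑ s, ∑ t, (g (x s) (x t) - 2 * g (x s) (y t) + g (y s) (y t)))

/-- The empirical RKHS variance of a sample of size `n`. -/
def empVar {n : ℕ} (x : Fin n → 𝒳) : ℝ :=
  1 / ((n : ℝ) - 1) * ∑ t, (g (x t) (x t) - 1 / (n : ℝ) * ∑ s, g (x t) (x s))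

/-- `log (8 (N² - N) / δ')`. -/
def logTerm (N : ℕ) (δ' : ℝ) : ℝ := Real.log (8 * ((N : ℝ) ^ 2 - N) / δ')

/-- The rejection threshold `𝓑^{i,j}(n, δ')` for the samples `x` of arm `i` and `y` of arm `j`. -/
def threshold (N : ℕ) (δ' : ℝ) {n : ℕ} (x y : Fin n → 𝒳) : ℝ :=
  (Real.sqrt (empVar g x) + Real.sqrt (empVar g y)) * Real.sqrt (2 * (logTerm N δ' / n)) +
    32 / 3 * Real.sqrt (kernelRange g) * (logTerm N δ' / n)

/-! ### The algorithm -/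

/-- The graph on the arms with an edge `{i, j}` whenever the hypothesis that `i` and `j` have the
same embedding is not rejected. -/
def clusterGraph {N n : ℕ} (δ' : ℝ) (x : Fin N → Fin n → 𝒳) : SimpleGraph (Fin N) :=
  SimpleGraph.fromRel fun i j => empMMD g (x i) (x j) ≤ threshold g N δ' (x i) (x j)

/-- `CLUSTER(n, δ')` run on `n` observations of each arm: the partition of the arms into the
connected components of the graph. -/
def cluster {N n : ℕ} (δ' : ℝ) (x : Fin N → Fin n → 𝒳) : Setoid (Fin N) :=
  (clusterGraph g δ' x).reachableSetoid

/-- `δ_k = δ / (4 k²)`. -/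
def confidence (δ : ℝ) (k : ℕ) : ℝ := δ / (4 * (k : ℝ) ^ 2)

/-- `n_k = ⌈2^k log (8 (N² - N) / δ_k)⌉`. -/
def perArmBudget (N : ℕ) (δ : ℝ) (k : ℕ) : ℕ :=
  ⌈2 ^ k * logTerm N (confidence δ k)⌉₊

/-- The number of times each arm has been pulled in the iterations `1, …, k - 1`. -/
def pullsBefore (N : ℕ) (δ : ℝ) (k : ℕ) : ℕ :=
  ∑ l ∈ Finset.Ico 1 k, perArmBudget N δ l

/-- The fresh observations used in iteration `k`, when `x i s` is the outcome of the `s`-th pull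
(counted from `0`) of arm `i`: the next `n_k` pulls of each arm. -/
def iterSample {N : ℕ} (δ : ℝ) (x : Fin N → ℕ → 𝒳) (k : ℕ) :
    Fin N → Fin (perArmBudget N δ k) → 𝒳 :=
  fun i t => x i (pullsBefore N δ k + t)

/-- `𝓒_k`, the result of `CLUSTER(n_k, δ_k)` in iteration `k`. -/
def iterClustering {N : ℕ} (δ : ℝ) (x : Fin N → ℕ → 𝒳) (k : ℕ) : Setoid (Fin N) :=
  cluster g (confidence δ k) (iterSample δ x k)

/-- Iteration `k` meets the stopping condition `|𝓒_k| = K`. -/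
def StopsAt {N : ℕ} (K : ℕ) (δ : ℝ) (x : Fin N → ℕ → 𝒳) (k : ℕ) : Prop :=
  1 ≤ k ∧ numClusters (iterClustering g δ x k) = K

open Classical in
/-- The output of `KABC(δ, K)` on the outcomes `x`: the clustering `𝓒_k` of the first iteration
`k ≥ 1` with `|𝓒_k| = K`, or `none` if the algorithm does not terminate. -/
def output {N : ℕ} (K : ℕ) (δ : ℝ) (x : Fin N → ℕ → 𝒳) : Option (Setoid (Fin N)) :=
  if h : ∃ k, StopsAt g K δ x k then some (iterClustering g δ x (Nat.find h)) else none

open Classical in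
/-- The total number `τ` of samples drawn by `KABC(δ, K)` on the outcomes `x`: `N · n_k` samples
in each iteration up to and including the last; `∞` if the algorithm does not terminate. -/
def budget {N : ℕ} (K : ℕ) (δ : ℝ) (x : Fin N → ℕ → 𝒳) : ℕ∞ :=
  if h : ∃ k, StopsAt g K δ x k then
    ((∑ k ∈ Finset.Icc 1 (Nat.find h), N * perArmBudget N δ k : ℕ) : ℕ∞)
  else ⊤

end Algorithm

/-- A clustering is correct if it groups together exactly the arms with the same embedding. -/
def IsCorrect {𝒳 : Type*} [MeasurableSpace 𝒳] (H : Type*) [NormedAddCommGroup H]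
    [InnerProductSpace ℝ H] [CompleteSpace H] [RKHS ℝ H 𝒳 ℝ] {N : ℕ}
    (ν : Fin N → ProbabilityMeasure 𝒳) (C : Setoid (Fin N)) : Prop :=
  ∀ i j, i ≠ j → (kme H (ν i : Measure 𝒳) = kme H (ν j : Measure 𝒳) ↔ C i j)

/-- The empirical kernel mean embedding `μ̂ = (1/n) ∑_t φ(X_t)`. -/
def empKME {𝒳 : Type*} (H : Type*) [NormedAddCommGroup H] [InnerProductSpace ℝ H]
    [CompleteSpace H] [RKHS ℝ H 𝒳 ℝ] {n : ℕ} (x : Fin n → 𝒳) : H :=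
  (1 / (n : ℝ)) • ∑ t, featureMap H (x t)

theorem inner_featureMap {𝒳 : Type*} {H : Type*} [NormedAddCommGroup H] [InnerProductSpace ℝ H]
    [CompleteSpace H] [RKHS ℝ H 𝒳 ℝ] {g : 𝒳 → 𝒳 → ℝ} (hH : HasKernel H g) (x y : 𝒳) :
    inner ℝ (featureMap H x) (featureMap H y) = g x y := by
  have h := RKHS.kernel_inner (𝕜 := ℝ) H y x (1 : ℝ) (1 : ℝ)
  have h2 : inner ℝ (featureMap H x) (featureMap H y) = g y x := by
    rw [featureMap, featureMap, ← h, hH]; simp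
  have h3 := RKHS.kernel_inner (𝕜 := ℝ) H x y (1 : ℝ) (1 : ℝ)
  rw [real_inner_comm]
  rw [featureMap, featureMap, ← h3, hH]; simp

/-- The statistic computed from the kernel is the RKHS distance of the empirical embeddings. -/
theorem empMMD_eq_norm {𝒳 : Type*} {H : Type*} [NormedAddCommGroup H] [InnerProductSpace ℝ H]
    [CompleteSpace H] [RKHS ℝ H 𝒳 ℝ] {g : 𝒳 → 𝒳 → ℝ} (hH : HasKernel H g) {n : ℕ}
    (x y : Fin n → 𝒳) : empMMD g x y = ‖empKME H y - empKME H x‖ := by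
  rw [empMMD, ← Real.sqrt_sq (norm_nonneg (empKME H y - empKME H x))]
  congr 1
  rw [← real_inner_self_eq_norm_sq, empKME, empKME, ← smul_sub, real_inner_smul_left,
    real_inner_smul_right]
  simp only [inner_sub_left, inner_sub_right, sum_inner, inner_sum, inner_featureMap hH]
  have hsym : ∀ a b, g a b = g b a := fun a b => by
    rw [← inner_featureMap hH, real_inner_comm, inner_featureMap hH]
  have h1 : ∑ s, ∑ t, g (y s) (x t) = ∑ s, ∑ t, g (x s) (y t) := by
    rw [Finset.sum_comm]
    exact Finset.sum_congr rfl fun s _ => Finset.sum_congr rfl fun t _ => hsym _ _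
  have h2 : ∀ u v : Fin n → 𝒳, ∑ s, ∑ t, g (u t) (v s) = ∑ s, ∑ t, g (u s) (v t) :=
    fun u v => Finset.sum_comm
  simp only [Finset.sum_add_distrib, Finset.sum_sub_distrib, ← Finset.mul_sum, h1, h2]
  ring

end KABC

end

/-!
The proof rests on a Bernstein inequality for sums of independent, centred, bounded vectors in a
Hilbert space (`measureReal_pi_norm_sum_gt_le`), with the same leading constant as for real
variables. It comes from the exponential moment `𝔼 cosh (c ‖S‖)`. Since `q ↦ cosh √q` is convex,
`cosh ‖s + x‖` is at most `cosh ‖s‖ (exp ‖x‖ - ‖x‖)` plus a term that is linear in `x`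
(`cosh_norm_add_le`). The linear term has mean zero, so each summand multiplies the moment by at
most `𝔼 (exp ‖x‖ - ‖x‖)`.

A sample is called typical (`IsTypical`) if Bernstein's bound holds both for the centred features
and for their centred squared norms. The empirical variance is, up to the factor `n / (n - 1)`, the
mean squared distance to the true embedding minus the squared error of the empirical embedding. On
a typical sample the empirical and the true standard deviations therefore differ by at most a
multiple of `√(g̃ L / n)`, where `L` is the logarithm in the threshold. Hence half the threshold
bounds the error of each empirical embedding (`IsTypical.norm_empKME_sub_le`), and if
`n ≥ (128 / s_*²) L`, the threshold is too small to hide a gap between two embeddings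
(`IsTypical.testWidth_add_norm_lt`).

So on a typical iteration the clustering is coarser than the true one, and equal to it from
iteration `k_*` on. A coarser partition with the right number of groups is the true one. An atypical
iteration `k` has probability at most `δ / (8 k²)` (`measureReal_not_isTypicalAt_le`). Summing over
`k` gives correctness, letting `k → ∞` gives almost sure termination, and `k = k_*` gives the bound
on the number of samples, because the budgets `n_k` grow geometrically and
`2 ^ k_* ≤ 2 (128 / s_*² ∨ 1)`.
-/

noncomputable section

namespace KABC

/-! ### Bernstein's inequality in a Hilbert space -/

section Concentration

/-- A consequence of the convexity of `q ↦ cosh √q`: if `r²` is the convex combination of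
`(a + b)²` and `(a - b)²` with weights `(1 ± t) / 2`, then `cosh r` is at most the same convex
combination of `cosh (a + b)` and `cosh (a - b)`. -/
theorem cosh_le_of_sq_eq {a b r t : ℝ} (ht : |t| ≤ 1)
    (hr : r ^ 2 = a ^ 2 + b ^ 2 + 2 * (a * b * t)) :
    Real.cosh r ≤ Real.cosh a * Real.cosh b + t * (Real.sinh a * Real.sinh b) := by
  obtain ⟨ht1, ht2⟩ := abs_le.1 ht
  have h := hasSum_le (fun n => ?_) (Real.hasSum_cosh r)
    (((Real.hasSum_cosh (a + b)).mul_left ((1 + t) / 2)).add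
      ((Real.hasSum_cosh (a - b)).mul_left ((1 - t) / 2)))
  · refine h.trans_eq ?_
    rw [Real.cosh_add, Real.cosh_sub]
    ring
  · have hc := (convexOn_pow (𝕜 := ℝ) n).2 (Set.mem_Ici.2 (sq_nonneg (a + b)))
      (Set.mem_Ici.2 (sq_nonneg (a - b))) (show 0 ≤ (1 + t) / 2 by linarith)
      (show 0 ≤ (1 - t) / 2 by linarith) (by ring)
    simp only [smul_eq_mul] at hc
    have he : (1 + t) / 2 * (a + b) ^ 2 + (1 - t) / 2 * (a - b) ^ 2 = r ^ 2 := by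
      rw [hr]; ring
    rw [he] at hc
    have hpos : (0 : ℝ) < ((2 * n).factorial : ℝ) := by positivity
    simp only [pow_mul]
    rw [← mul_div_assoc, ← mul_div_assoc, ← add_div]
    gcongr

/-- One-step inequality for the exponential moments of the norm of a sum of independent centred
vectors: the last term is linear in `x`, so it vanishes in expectation. -/
theorem cosh_norm_add_le {E : Type*} [NormedAddCommGroup E] [InnerProductSpace ℝ E] (s x : E) :
    Real.cosh ‖s + x‖ ≤ Real.cosh ‖s‖ * (Real.exp ‖x‖ - ‖x‖) +
      Real.sinh ‖s‖ / ‖s‖ * inner ℝ s x := by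
  obtain ⟨t, ht, hin⟩ : ∃ t : ℝ, |t| ≤ 1 ∧ inner ℝ s x = ‖s‖ * ‖x‖ * t := by
    refine ⟨inner ℝ s x / (‖s‖ * ‖x‖), abs_real_inner_div_norm_mul_norm_le_one s x, ?_⟩
    by_cases h : ‖s‖ * ‖x‖ = 0
    · have := abs_real_inner_le_norm s x
      rw [h] at this ⊢
      simpa using this
    · rw [mul_div_cancel₀ _ h]
  have h1 := cosh_le_of_sq_eq (a := ‖s‖) (b := ‖x‖) (r := ‖s + x‖) ht
    (by rw [norm_add_sq_real, hin]; ring)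
  have hlin : Real.sinh ‖s‖ / ‖s‖ * inner ℝ s x = t * Real.sinh ‖s‖ * ‖x‖ := by
    rw [hin]
    by_cases h : ‖s‖ = 0
    · simp [h]
    · field_simp
  have h2 : ‖x‖ ≤ Real.sinh ‖x‖ := Real.self_le_sinh_iff.2 (norm_nonneg x)
  have h3 : t * Real.sinh ‖s‖ ≤ Real.cosh ‖s‖ := by
    have h0 : 0 ≤ Real.sinh ‖s‖ := Real.sinh_nonneg_iff.2 (norm_nonneg s)
    have h4 : t * Real.sinh ‖s‖ ≤ Real.sinh ‖s‖ :=
      mul_le_of_le_one_left h0 (abs_le.1 ht).2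
    exact h4.trans (Real.sinh_lt_cosh _).le
  have h4 := mul_le_mul_of_nonneg_right h3 (sub_nonneg.2 h2)
  rw [hlin, ← Real.cosh_add_sinh ‖x‖]
  linarith

theorem exp_sub_self_le {b M : ℝ} (hb : 0 ≤ b) (hbM : b ≤ M) (hM : M < 3) :
    Real.exp b - b ≤ 1 + b ^ 2 / (2 * (1 - M / 3)) := by
  have hs := (hasSum_nat_add_iff' 2).2 (NormedSpace.expSeries_div_hasSum_exp (𝔸 := ℝ) b)
  rw [← Real.exp_eq_exp_ℝ] at hs
  have hg := (hasSum_geometric_of_lt_one (r := b / 3) (by positivity) (by linarith)).mul_left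
    (b ^ 2 / 2)
  have h := hasSum_le (fun n => ?_) hs hg
  · have h5 : b ^ 2 / 2 * (1 - b / 3)⁻¹ ≤ b ^ 2 / (2 * (1 - M / 3)) := by
      rw [← div_eq_mul_inv, div_div]
      have : (0 : ℝ) < 2 * (1 - M / 3) := by linarith
      gcongr
    simp only [Finset.sum_range_succ, Finset.sum_range_zero] at h
    norm_num at h
    linarith
  · have hf : (2 : ℝ) * 3 ^ n ≤ ((n + 2).factorial : ℝ) := by
      have := Nat.factorial_mul_pow_le_factorial (m := 2) (n := n)
      rw [add_comm n 2]
      exact_mod_cast this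
    calc b ^ (n + 2) / ((n + 2).factorial : ℝ) ≤ b ^ (n + 2) / (2 * 3 ^ n) := by gcongr
      _ = b ^ 2 / 2 * (b / 3) ^ n := by rw [div_pow, pow_add]; field_simp

variable {𝒳 : Type*} [MeasurableSpace 𝒳] {E : Type*} [NormedAddCommGroup E]
  [InnerProductSpace ℝ E] [CompleteSpace E]

omit [InnerProductSpace ℝ E] [CompleteSpace E] in
theorem stronglyMeasurable_sum_pi {f : 𝒳 → E} (hf : StronglyMeasurable f) (n : ℕ) :
    StronglyMeasurable fun x : Fin n → 𝒳 => ∑ t, f (x t) :=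
  Finset.stronglyMeasurable_fun_sum _ fun t _ => hf.comp_measurable (measurable_pi_apply t)

theorem integral_cosh_norm_add_le {ν : Measure 𝒳} [IsProbabilityMeasure ν] {f : 𝒳 → E}
    (hf : StronglyMeasurable f) {M V : ℝ} (hM : M < 3) (hfM : ∀ x, ‖f x‖ ≤ M)
    (hf0 : ∫ x, f x ∂ν = 0) (hfV : ∫ x, ‖f x‖ ^ 2 ∂ν ≤ V) (s : E) :
    ∫ x, Real.cosh ‖s + f x‖ ∂ν ≤ Real.cosh ‖s‖ * (1 + V / (2 * (1 - M / 3))) := by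
  have hfi : Integrable f ν := Integrable.of_bound hf.aestronglyMeasurable M
    (Filter.Eventually.of_forall hfM)
  have hsq : Integrable (fun x => ‖f x‖ ^ 2) ν :=
    Integrable.of_bound (hf.norm.pow 2).aestronglyMeasurable (M ^ 2)
      (Filter.Eventually.of_forall fun x => by
        rw [Real.norm_of_nonneg (by positivity)]; gcongr; exact hfM x)
  have hin : Integrable (fun x => inner ℝ s (f x)) ν := hfi.const_inner s
  have hM3 : (0 : ℝ) < 2 * (1 - M / 3) := by linarith
  have hpt : ∀ x, Real.cosh ‖s + f x‖ ≤
      Real.cosh ‖s‖ * (1 + ‖f x‖ ^ 2 / (2 * (1 - M / 3))) +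
        Real.sinh ‖s‖ / ‖s‖ * inner ℝ s (f x) := fun x => by
    refine (cosh_norm_add_le s (f x)).trans ?_
    have := exp_sub_self_le (norm_nonneg (f x)) (hfM x) hM
    have h0 := Real.cosh_pos ‖s‖
    gcongr
  have hi1 : Integrable (fun x => Real.cosh ‖s‖ * (1 + ‖f x‖ ^ 2 / (2 * (1 - M / 3)))) ν :=
    ((integrable_const _).add (hsq.div_const _)).const_mul _
  have hi2 : Integrable (fun x => Real.sinh ‖s‖ / ‖s‖ * inner ℝ s (f x)) ν := hin.const_mul _
  calc ∫ x, Real.cosh ‖s + f x‖ ∂ν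
      ≤ ∫ x, (Real.cosh ‖s‖ * (1 + ‖f x‖ ^ 2 / (2 * (1 - M / 3))) +
        Real.sinh ‖s‖ / ‖s‖ * inner ℝ s (f x)) ∂ν :=
        integral_mono_of_nonneg (Filter.Eventually.of_forall fun x => (Real.cosh_pos _).le)
          (hi1.add hi2) (Filter.Eventually.of_forall hpt)
    _ = Real.cosh ‖s‖ * (1 + (∫ x, ‖f x‖ ^ 2 ∂ν) / (2 * (1 - M / 3))) := by
        rw [integral_add hi1 hi2, integral_const_mul, integral_const_mul,
          integral_add (integrable_const _) (hsq.div_const _), integral_div,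
          integral_inner hfi, hf0]
        simp
    _ ≤ _ := by
        have h0 := Real.cosh_pos ‖s‖
        gcongr

theorem integral_cosh_norm_sum_le {ν : Measure 𝒳} [IsProbabilityMeasure ν] {f : 𝒳 → E}
    (hf : StronglyMeasurable f) {M V : ℝ} (hM : M < 3) (hfM : ∀ x, ‖f x‖ ≤ M)
    (hf0 : ∫ x, f x ∂ν = 0) (hfV : ∫ x, ‖f x‖ ^ 2 ∂ν ≤ V) (n : ℕ) :
    ∫ x : Fin n → 𝒳, Real.cosh ‖∑ t, f (x t)‖ ∂(Measure.pi fun _ => ν) ≤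
      (1 + V / (2 * (1 - M / 3))) ^ n := by
  have hV0 : 0 ≤ V := (integral_nonneg fun x => by positivity).trans hfV
  have hM3 : (0 : ℝ) < 2 * (1 - M / 3) := by linarith
  induction n with
  | zero => simp
  | succ n ih =>
    have hbd : ∀ (m : ℕ) (x : Fin m → 𝒳), ‖Real.cosh ‖∑ t, f (x t)‖‖ ≤ Real.cosh (m * M) := by
      intro m x
      rw [Real.norm_of_nonneg (Real.cosh_pos _).le]
      have h1 : ‖∑ t, f (x t)‖ ≤ m * M := by
        refine (norm_sum_le _ _).trans ((Finset.sum_le_sum fun t _ => hfM (x t)).trans ?_)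
        simp
      rw [Real.cosh_le_cosh, abs_of_nonneg (norm_nonneg _)]
      exact h1.trans (le_abs_self _)
    have hsm : ∀ m : ℕ, StronglyMeasurable fun x : Fin m → 𝒳 => Real.cosh ‖∑ t, f (x t)‖ :=
      fun m => Real.continuous_cosh.comp_stronglyMeasurable (stronglyMeasurable_sum_pi hf m).norm
    have hint : ∀ m : ℕ, Integrable (fun x : Fin m → 𝒳 => Real.cosh ‖∑ t, f (x t)‖)
        (Measure.pi fun _ => ν) := fun m =>
      Integrable.of_bound (hsm m).aestronglyMeasurable _ (Filter.Eventually.of_forall (hbd m))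
    have hmp := measurePreserving_piFinSuccAbove (fun _ : Fin (n + 1) => ν) 0
    have hmp' := hmp.symm (MeasurableEquiv.piFinSuccAbove (fun _ : Fin (n + 1) => 𝒳) 0)
    have hint' := hmp'.integrable_comp_of_integrable (hint (n + 1))
    have heq := hmp'.integral_comp' fun x : Fin (n + 1) → 𝒳 => Real.cosh ‖∑ t, f (x t)‖
    rw [← heq]
    refine (integral_prod_symm _ hint').trans_le ?_
    have hstep : ∀ y : Fin n → 𝒳, ∫ x : 𝒳, Real.cosh ‖∑ t, f
        ((MeasurableEquiv.piFinSuccAbove (fun _ : Fin (n + 1) => 𝒳) 0).symm (x, y) t)‖ ∂ν ≤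
        Real.cosh ‖∑ t, f (y t)‖ * (1 + V / (2 * (1 - M / 3))) := fun y => by
      have := integral_cosh_norm_add_le hf hM hfM hf0 hfV (∑ t, f (y t))
      refine le_of_eq_of_le (integral_congr_ae (Filter.Eventually.of_forall fun x => ?_)) this
      simp [MeasurableEquiv.piFinSuccAbove, Fin.sum_univ_succ, Fin.insertNthEquiv, add_comm]
    calc _ ≤ ∫ y : Fin n → 𝒳, Real.cosh ‖∑ t, f (y t)‖ * (1 + V / (2 * (1 - M / 3)))
            ∂(Measure.pi fun _ => ν) :=
          integral_mono_of_nonneg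
            (Filter.Eventually.of_forall fun y => integral_nonneg fun x => (Real.cosh_pos _).le)
            ((hint n).mul_const _) (Filter.Eventually.of_forall hstep)
      _ ≤ _ := by
          rw [integral_mul_const, pow_succ]
          gcongr

/-- Bernstein's inequality for sums of independent, identically distributed, centred and bounded
vectors in a Hilbert space, with the leading constant of the scalar inequality. -/
theorem measureReal_pi_norm_sum_gt_le {ν : Measure 𝒳} [IsProbabilityMeasure ν] {f : 𝒳 → E}
    (hf : StronglyMeasurable f) {M V L : ℝ} (hM : 0 ≤ M) (hfM : ∀ x, ‖f x‖ ≤ M)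
    (hf0 : ∫ x, f x ∂ν = 0) (hfV : ∫ x, ‖f x‖ ^ 2 ∂ν ≤ V) (hL : 0 ≤ L) (n : ℕ) :
    (Measure.pi fun _ : Fin n => ν).real
      {x | Real.sqrt (2 * n * V * L) + M * L / 3 < ‖∑ t, f (x t)‖} ≤ 2 * Real.exp (-L) := by
  have hV0 : 0 ≤ V := (integral_nonneg fun x => by positivity).trans hfV
  have hML : 0 ≤ M * L / 3 := by positivity
  rcases hL.eq_or_lt with rfl | hLpos
  · refine measureReal_le_one.trans ?_
    simp
  rcases hV0.eq_or_lt with rfl | hVpos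
  · -- without variance the vectors vanish almost surely
    have hsq : Integrable (fun x => ‖f x‖ ^ 2) ν :=
      Integrable.of_bound (hf.norm.pow 2).aestronglyMeasurable (M ^ 2)
        (Filter.Eventually.of_forall fun x => by
          rw [Real.norm_of_nonneg (by positivity)]; gcongr; exact hfM x)
    have h0 : ∀ᵐ x ∂ν, f x = 0 := by
      have h1 := (integral_eq_zero_iff_of_nonneg (fun x => by positivity) hsq).1
        (le_antisymm hfV (integral_nonneg fun x => by positivity))
      filter_upwards [h1] with x hx
      simpa using hx
    have h2 : ∀ᵐ x ∂(Measure.pi fun _ : Fin n => ν), ∀ t, f (x t) = 0 :=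
      ae_all_iff.2 fun t =>
        (Measure.tendsto_eval_ae_ae (μ := fun _ : Fin n => ν) (i := t)).eventually h0
    have h3 : (Measure.pi fun _ : Fin n => ν)
        {x | Real.sqrt (2 * n * 0 * L) + M * L / 3 < ‖∑ t, f (x t)‖} = 0 := by
      refine measure_mono_null (fun x hx => ?_) (ae_iff.1 h2)
      rw [Set.mem_ofPred_eq] at hx ⊢
      intro hx'
      rw [Finset.sum_eq_zero fun t _ => hx' t] at hx
      simp only [mul_zero, zero_mul, Real.sqrt_zero, zero_add, norm_zero] at hx
      linarith
    rw [measureReal_def, h3]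
    positivity
  rcases Nat.eq_zero_or_pos n with rfl | hn
  · have : {x : Fin 0 → 𝒳 | Real.sqrt (2 * (0 : ℕ) * V * L) + M * L / 3 < ‖∑ t, f (x t)‖} = ∅ := by
      ext x
      simpa using hML
    rw [this]
    simp only [measureReal_empty]
    positivity
  have hn' : (0 : ℝ) < n := by exact_mod_cast hn
  set r := Real.sqrt (2 * n * V * L) + M * L / 3 with hr
  -- `c = z / (1 + M z / 3)` is the exponent that makes the sub-gamma bound equal to `exp (-L)`
  set y := Real.sqrt (2 * n * V * L) with hy
  have hypos : 0 < y := Real.sqrt_pos.2 (by positivity)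
  have hysq : y ^ 2 = 2 * n * V * L := Real.sq_sqrt (by positivity)
  set z := y / (n * V) with hz
  have hzpos : 0 < z := by positivity
  have hyz : y = n * V * z := by rw [hz]; field_simp
  have hyz2 : y * z = 2 * L := by
    rw [hz, ← mul_div_assoc, ← sq, hysq]; field_simp
  have hden : 0 < 1 + M * z / 3 := by positivity
  set c := z / (1 + M * z / 3) with hc
  have hcpos : 0 < c := by positivity
  have hcM : c * M < 3 := by
    rw [hc, div_mul_eq_mul_div, div_lt_iff₀ hden]
    nlinarith
  have hcz : c / (1 - c * M / 3) = z := by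
    have h1 : 1 - c * M / 3 = 1 / (1 + M * z / 3) := by
      rw [hc]; field_simp; ring
    rw [h1, hc]; field_simp
  have hmgf := integral_cosh_norm_sum_le (ν := ν) (hf.const_smul c) hcM
    (fun x => by
      rw [Pi.smul_apply, norm_smul, Real.norm_of_nonneg hcpos.le]
      exact mul_le_mul_of_nonneg_left (hfM x) hcpos.le)
    (by simp only [Pi.smul_apply]; rw [integral_smul, hf0, smul_zero])
    (V := c ^ 2 * V) (by
      simp only [Pi.smul_apply, norm_smul, mul_pow]
      rw [integral_const_mul, Real.norm_of_nonneg hcpos.le]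
      gcongr) n
  have hsum : ∀ x : Fin n → 𝒳, ‖∑ t, (c • f) (x t)‖ = c * ‖∑ t, f (x t)‖ := fun x => by
    simp only [Pi.smul_apply]
    rw [← Finset.smul_sum, norm_smul, Real.norm_of_nonneg hcpos.le]
  simp only [hsum] at hmgf
  have hexp : (1 + c ^ 2 * V / (2 * (1 - c * M / 3))) ^ n ≤ Real.exp (c * y / 2) := by
    have h1 : c ^ 2 * V / (2 * (1 - c * M / 3)) = c * V * z / 2 := by
      rw [← hcz]
      have : 1 - c * M / 3 ≠ 0 := by linarith
      field_simp
    rw [h1]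
    calc (1 + c * V * z / 2) ^ n ≤ (Real.exp (c * V * z / 2)) ^ n := by
          gcongr
          rw [add_comm]
          exact Real.add_one_le_exp _
      _ = Real.exp (c * y / 2) := by
          rw [← Real.exp_nat_mul, hyz]
          ring_nf
  have hint : Integrable (fun x : Fin n → 𝒳 => Real.cosh (c * ‖∑ t, f (x t)‖))
      (Measure.pi fun _ => ν) := by
    refine Integrable.of_bound (Real.continuous_cosh.comp_stronglyMeasurable
      ((stronglyMeasurable_sum_pi hf n).norm.const_mul c)).aestronglyMeasurable
      (Real.cosh (c * (n * M))) (Filter.Eventually.of_forall fun x => ?_)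
    rw [Real.norm_of_nonneg (Real.cosh_pos _).le, Real.cosh_le_cosh, abs_of_nonneg (by positivity),
      abs_of_nonneg (by positivity)]
    gcongr
    refine (norm_sum_le _ _).trans ((Finset.sum_le_sum fun t _ => hfM (x t)).trans ?_)
    simp
  have hmarkov := mul_meas_ge_le_integral_of_nonneg
    (Filter.Eventually.of_forall fun x => (Real.cosh_pos _).le) hint (Real.cosh (c * r))
  have hsub : (Measure.pi fun _ : Fin n => ν).real {x | r < ‖∑ t, f (x t)‖} ≤
      (Measure.pi fun _ : Fin n => ν).real
        {x | Real.cosh (c * r) ≤ Real.cosh (c * ‖∑ t, f (x t)‖)} := by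
    refine measureReal_mono fun x hx => ?_
    have hr0 : 0 ≤ r := by positivity
    rw [Set.mem_ofPred_eq] at hx ⊢
    rw [Real.cosh_le_cosh, abs_of_nonneg (by positivity),
      abs_of_nonneg (by positivity)]
    gcongr
  have hcosh : Real.exp (c * r) / 2 ≤ Real.cosh (c * r) := by
    rw [Real.cosh_eq]
    have := Real.exp_pos (-(c * r))
    linarith
  set p := (Measure.pi fun _ : Fin n => ν).real {x | r < ‖∑ t, f (x t)‖} with hp
  have hp0 : 0 ≤ p := measureReal_nonneg
  have h1 : Real.exp (c * r) / 2 * p ≤ Real.exp (c * y / 2) :=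
    calc Real.exp (c * r) / 2 * p ≤ Real.cosh (c * r) * p := by gcongr
      _ ≤ _ := mul_le_mul_of_nonneg_left hsub (Real.cosh_pos _).le
      _ ≤ _ := hmarkov
      _ ≤ _ := hmgf
      _ ≤ _ := hexp
  have h2 : c * r = L + c * y / 2 := by
    have h3 : z * r = L * (1 + M * z / 3) + z * y / 2 := by
      rw [hr]; linear_combination hyz2 / 2
    rw [hc, div_mul_eq_mul_div, h3]
    field_simp
  rw [h2, Real.exp_add] at h1
  have h4 : 0 < Real.exp (c * y / 2) := Real.exp_pos _
  have h5 : Real.exp L * p ≤ 2 := by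
    by_contra! h
    nlinarith
  rw [Real.exp_neg, ← div_eq_mul_inv, le_div_iff₀ (Real.exp_pos L)]
  linarith

theorem measureReal_norm_sum_gt_le {ν : Measure 𝒳} [IsProbabilityMeasure ν] {f : 𝒳 → E}
    (hf : StronglyMeasurable f) {M V L : ℝ} (hM : 0 ≤ M) (hfM : ∀ x, ‖f x‖ ≤ M)
    (hf0 : ∫ x, f x ∂ν = 0) (hfV : ∫ x, ‖f x‖ ^ 2 ∂ν ≤ V) (hL : 0 ≤ L)
    {Ω : Type*} [MeasurableSpace Ω] {P : Measure Ω} [IsProbabilityMeasure P] {n : ℕ}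
    {Y : Fin n → Ω → 𝒳} (hY : ∀ t, Measurable (Y t)) (hlaw : ∀ t, P.map (Y t) = ν)
    (hind : iIndepFun Y P) :
    P.real {ω | Real.sqrt (2 * n * V * L) + M * L / 3 < ‖∑ t, f (Y t ω)‖} ≤
      2 * Real.exp (-L) := by
  have hpi := (iIndepFun_iff_map_fun_eq_pi_map fun t => (hY t).aemeasurable).1 hind
  simp only [hlaw] at hpi
  have h := measureReal_pi_norm_sum_gt_le hf hM hfM hf0 hfV hL n
  rw [← hpi, map_measureReal_apply (measurable_pi_lambda _ hY)
    (measurableSet_lt measurable_const (stronglyMeasurable_sum_pi hf n).norm.measurable)] at h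
  exact h

end Concentration

/-! ### Translation-invariant kernels and their features -/

section KernelFacts

variable {𝒳 : Type*} [AddGroup 𝒳] {g : 𝒳 → 𝒳 → ℝ}

theorem IsTranslationInvariant.apply_self (hti : IsTranslationInvariant g) (x : 𝒳) :
    g x x = g 0 0 := by
  obtain ⟨Ψ, hΨ⟩ := hti
  rw [hΨ, hΨ, sub_self, sub_self]

variable {H : Type*} [NormedAddCommGroup H] [InnerProductSpace ℝ H] [CompleteSpace H]
  [RKHS ℝ H 𝒳 ℝ]

theorem norm_featureMap_sq (hH : HasKernel H g) (hti : IsTranslationInvariant g) (x : 𝒳) :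
    ‖featureMap H x‖ ^ 2 = g 0 0 := by
  rw [← real_inner_self_eq_norm_sq, inner_featureMap hH, hti.apply_self]

theorem kernel_abs_le (hH : HasKernel H g) (hti : IsTranslationInvariant g) (x y : 𝒳) :
    |g x y| ≤ g 0 0 := by
  have h := abs_real_inner_le_norm (featureMap H x) (featureMap H y)
  have h1 := norm_featureMap_sq hH hti x
  have h2 := norm_featureMap_sq hH hti y
  rw [inner_featureMap hH] at h
  nlinarith [sq_nonneg (‖featureMap H x‖ - ‖featureMap H y‖)]

theorem bddAbove_range_kernel (hH : HasKernel H g) (hti : IsTranslationInvariant g) :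
    BddAbove (Set.range fun p : 𝒳 × 𝒳 => g p.1 p.2) :=
  ⟨g 0 0, by rintro _ ⟨p, rfl⟩; exact (abs_le.1 (kernel_abs_le hH hti p.1 p.2)).2⟩

theorem bddBelow_range_kernel (hH : HasKernel H g) (hti : IsTranslationInvariant g) :
    BddBelow (Set.range fun p : 𝒳 × 𝒳 => g p.1 p.2) :=
  ⟨-g 0 0, by rintro _ ⟨p, rfl⟩; exact (abs_le.1 (kernel_abs_le hH hti p.1 p.2)).1⟩

theorem kernelSup_eq (hH : HasKernel H g) (hti : IsTranslationInvariant g) :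
    kernelSup g = g 0 0 :=
  le_antisymm (ciSup_le fun p => (abs_le.1 (kernel_abs_le hH hti p.1 p.2)).2)
    (le_ciSup (bddAbove_range_kernel hH hti) (0, 0))

theorem sub_le_kernelRange (hH : HasKernel H g) (hti : IsTranslationInvariant g) (x y : 𝒳) :
    g 0 0 - g x y ≤ kernelRange g :=
  sub_le_sub (le_ciSup (bddAbove_range_kernel hH hti) (0, 0))
    (ciInf_le (bddBelow_range_kernel hH hti) (x, y))

theorem kernelRange_nonneg (hH : HasKernel H g) (hti : IsTranslationInvariant g) :
    0 ≤ kernelRange g := by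
  simpa using sub_le_kernelRange hH hti 0 0

theorem kernelRange_le (hH : HasKernel H g) (hti : IsTranslationInvariant g) :
    kernelRange g ≤ 2 * kernelSup g := by
  have h1 : -g 0 0 ≤ ⨅ p : 𝒳 × 𝒳, g p.1 p.2 :=
    le_ciInf fun p => (abs_le.1 (kernel_abs_le hH hti p.1 p.2)).1
  have h2 := kernelSup_eq hH hti
  rw [kernelSup] at h2
  rw [kernelRange, kernelSup]
  linarith

theorem norm_featureMap_sub_le (hH : HasKernel H g) (hti : IsTranslationInvariant g) (x y : 𝒳) :
    ‖featureMap H x - featureMap H y‖ ≤ Real.sqrt (2 * kernelRange g) := by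
  refine Real.le_sqrt_of_sq_le ?_
  rw [norm_sub_sq_real, norm_featureMap_sq hH hti, norm_featureMap_sq hH hti, inner_featureMap hH]
  linarith [sub_le_kernelRange hH hti x y]

variable [TopologicalSpace 𝒳]

omit [AddGroup 𝒳] in
theorem continuous_featureMap (hH : HasKernel H g)
    (hg : Continuous fun p : 𝒳 × 𝒳 => g p.1 p.2) : Continuous (featureMap H : 𝒳 → H) := by
  refine continuous_iff_continuousAt.2 fun x => tendsto_iff_norm_sub_tendsto_zero.2 ?_
  have h : ∀ y, ‖featureMap H y - featureMap H x‖ =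
      Real.sqrt (g y y - 2 * g y x + g x x) := fun y => by
    rw [← Real.sqrt_sq (norm_nonneg (featureMap H y - featureMap H x)), norm_sub_sq_real,
      ← real_inner_self_eq_norm_sq, ← real_inner_self_eq_norm_sq]
    simp only [inner_featureMap hH]
  simp only [h]
  have hc : Continuous fun y => Real.sqrt (g y y - 2 * g y x + g x x) := by
    have h1 : Continuous fun y => g y y := hg.comp (continuous_id.prodMk continuous_id)
    have h2 : Continuous fun y => g y x := hg.comp (continuous_id.prodMk continuous_const)
    fun_prop
  have := hc.tendsto x
  simpa [show g x x - 2 * g x x + g x x = 0 by ring] using this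

variable [TopologicalSpace.SeparableSpace 𝒳] [MeasurableSpace 𝒳] [BorelSpace 𝒳]

omit [AddGroup 𝒳] in
/-- The space `𝒳` need not be second countable, but the range of the feature map is separable. -/
theorem stronglyMeasurable_featureMap (hH : HasKernel H g)
    (hg : Continuous fun p : 𝒳 × 𝒳 => g p.1 p.2) :
    StronglyMeasurable (featureMap H : 𝒳 → H) := by
  borelize H
  have hc := continuous_featureMap hH hg
  exact stronglyMeasurable_iff_measurable_separable.2
    ⟨hc.measurable, TopologicalSpace.isSeparable_range hc⟩

variable (ν : Measure 𝒳) [IsProbabilityMeasure ν]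

theorem integrable_featureMap (hH : HasKernel H g) (hti : IsTranslationInvariant g)
    (hg : Continuous fun p : 𝒳 × 𝒳 => g p.1 p.2) : Integrable (featureMap H : 𝒳 → H) ν :=
  Integrable.of_bound (stronglyMeasurable_featureMap hH hg).aestronglyMeasurable
    (Real.sqrt (g 0 0)) (Filter.Eventually.of_forall fun x =>
      Real.le_sqrt_of_sq_le (norm_featureMap_sq hH hti x).le)

theorem integral_featureMap_sub_kme (hH : HasKernel H g) (hti : IsTranslationInvariant g)
    (hg : Continuous fun p : 𝒳 × 𝒳 => g p.1 p.2) :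
    ∫ x, (featureMap H x - kme H ν) ∂ν = 0 := by
  rw [integral_sub (integrable_featureMap ν hH hti hg) (integrable_const _), kme]
  simp

theorem norm_featureMap_sub_kme_le (hH : HasKernel H g) (hti : IsTranslationInvariant g)
    (hg : Continuous fun p : 𝒳 × 𝒳 => g p.1 p.2) (x : 𝒳) :
    ‖featureMap H x - kme H ν‖ ≤ Real.sqrt (2 * kernelRange g) := by
  have h : featureMap H x - kme H ν = ∫ y, (featureMap H x - featureMap H y) ∂ν := by
    rw [integral_sub (integrable_const _) (integrable_featureMap ν hH hti hg), kme]
    simp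
  rw [h]
  refine (norm_integral_le_of_norm_le_const (Filter.Eventually.of_forall fun y =>
    norm_featureMap_sub_le hH hti x y)).trans ?_
  simp

theorem sq_norm_featureMap_sub_kme_le (hH : HasKernel H g) (hti : IsTranslationInvariant g)
    (hg : Continuous fun p : 𝒳 × 𝒳 => g p.1 p.2) (x : 𝒳) :
    ‖featureMap H x - kme H ν‖ ^ 2 ≤ 2 * kernelRange g := by
  have := norm_featureMap_sub_kme_le ν hH hti hg x
  rwa [Real.le_sqrt (norm_nonneg _) (by have := kernelRange_nonneg hH hti; positivity)] at this

theorem integrable_sq_norm_featureMap_sub_kme (hH : HasKernel H g)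
    (hti : IsTranslationInvariant g) (hg : Continuous fun p : 𝒳 × 𝒳 => g p.1 p.2) :
    Integrable (fun x => ‖featureMap H x - kme H ν‖ ^ 2) ν :=
  Integrable.of_bound (((stronglyMeasurable_featureMap hH hg).sub
    stronglyMeasurable_const).norm.pow 2).aestronglyMeasurable (2 * kernelRange g)
    (Filter.Eventually.of_forall fun x => by
      rw [Real.norm_of_nonneg (by positivity)]
      exact sq_norm_featureMap_sub_kme_le ν hH hti hg x)

omit [AddGroup 𝒳] [TopologicalSpace 𝒳] [TopologicalSpace.SeparableSpace 𝒳] [BorelSpace 𝒳]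
  [IsProbabilityMeasure ν] in
theorem rkhsVar_nonneg : 0 ≤ rkhsVar H ν :=
  integral_nonneg fun x => by positivity

theorem rkhsVar_le (hH : HasKernel H g) (hti : IsTranslationInvariant g)
    (hg : Continuous fun p : 𝒳 × 𝒳 => g p.1 p.2) : rkhsVar H ν ≤ kernelRange g := by
  have hi := integrable_featureMap ν hH hti hg
  -- `⟪φ x, μ⟫` and `‖μ‖²` are averages of values of the kernel
  have h1 : ∀ x, g 0 0 - kernelRange g ≤ inner ℝ (featureMap H x) (kme H ν) := fun x => by
    rw [kme, ← integral_inner hi]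
    have : ∫ _, (g 0 0 - kernelRange g) ∂ν ≤
        ∫ y, inner ℝ (featureMap H x) (featureMap H y) ∂ν :=
      integral_mono (integrable_const _) (hi.const_inner _) fun y => by
        have := sub_le_kernelRange hH hti x y
        simp only [inner_featureMap hH]
        linarith
    simpa using this
  have h2 : ∫ x, inner ℝ (featureMap H x) (kme H ν) ∂ν = ‖kme H ν‖ ^ 2 := by
    simp only [real_inner_comm (kme H ν)]
    rw [integral_inner hi, ← real_inner_self_eq_norm_sq, kme]
  have h3 : g 0 0 - kernelRange g ≤ ‖kme H ν‖ ^ 2 := by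
    rw [← h2]
    have : ∫ _, (g 0 0 - kernelRange g) ∂ν ≤ ∫ x, inner ℝ (featureMap H x) (kme H ν) ∂ν :=
      integral_mono (integrable_const _) (hi.inner_const _) h1
    simpa using this
  have h4 : rkhsVar H ν = g 0 0 - ‖kme H ν‖ ^ 2 := by
    rw [rkhsVar]
    simp only [norm_sub_sq_real, norm_featureMap_sq hH hti]
    have h5 : Integrable (fun x => 2 * inner ℝ (featureMap H x) (kme H ν)) ν :=
      (hi.inner_const _).const_mul 2
    have h6 : Integrable (fun x => g 0 0 - 2 * inner ℝ (featureMap H x) (kme H ν)) ν :=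
      (integrable_const _).sub h5
    rw [integral_add h6 (integrable_const _), integral_sub (integrable_const _) h5,
      integral_const_mul, h2]
    simp
    ring
  linarith

end KernelFacts

/-! ### The empirical variance -/

section EmpiricalVariance

variable {𝒳 : Type*} {g : 𝒳 → 𝒳 → ℝ} {H : Type*} [NormedAddCommGroup H]
  [InnerProductSpace ℝ H] [CompleteSpace H] [RKHS ℝ H 𝒳 ℝ]

theorem empKME_sub {n : ℕ} (hn : n ≠ 0) (x : Fin n → 𝒳) (m : H) :
    empKME H x - m = (1 / (n : ℝ)) • ∑ t, (featureMap H (x t) - m) := by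
  have hn' : (n : ℝ) ≠ 0 := by exact_mod_cast hn
  rw [empKME, Finset.sum_sub_distrib, smul_sub, Finset.sum_const, Finset.card_univ,
    Fintype.card_fin, ← Nat.cast_smul_eq_nsmul ℝ, smul_smul, one_div_mul_cancel hn', one_smul]

/-- The bias-variance decomposition of the empirical variance around an arbitrary centre. -/
theorem sub_one_mul_empVar (hH : HasKernel H g) {n : ℕ} (hn : 2 ≤ n) (x : Fin n → 𝒳) (m : H) :
    ((n : ℝ) - 1) * empVar g x =
      ∑ t, ‖featureMap H (x t) - m‖ ^ 2 - n * ‖empKME H x - m‖ ^ 2 := by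
  have hn' : (2 : ℝ) ≤ n := by exact_mod_cast hn
  have hn0 : (n : ℝ) ≠ 0 := by linarith
  have hn1 : (n : ℝ) - 1 ≠ 0 := by linarith
  have hS : ∑ t, featureMap H (x t) = (n : ℝ) • empKME H x := by
    rw [empKME, smul_smul, mul_one_div_cancel hn0, one_smul]
  have h1 : ∑ t, ∑ s, g (x t) (x s) = n ^ 2 * ‖empKME H x‖ ^ 2 := by
    have : ∑ t, ∑ s, g (x t) (x s) =
        inner ℝ (∑ t, featureMap H (x t)) (∑ s, featureMap H (x s)) := by
      rw [sum_inner]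
      simp only [inner_sum, inner_featureMap hH]
    rw [this, hS, real_inner_self_eq_norm_sq, norm_smul, mul_pow,
      Real.norm_of_nonneg (by positivity)]
  have h2 : ∑ t, ‖featureMap H (x t) - m‖ ^ 2 =
      ∑ t, g (x t) (x t) - 2 * (n * inner ℝ (empKME H x) m) + n * ‖m‖ ^ 2 := by
    simp only [norm_sub_sq_real]
    rw [Finset.sum_add_distrib, Finset.sum_sub_distrib, ← Finset.mul_sum, ← sum_inner, hS,
      real_inner_smul_left]
    have h3 : ∀ t, ‖featureMap H (x t)‖ ^ 2 = g (x t) (x t) := fun t => by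
      rw [← real_inner_self_eq_norm_sq, inner_featureMap hH]
    simp [h3]
  rw [h2, norm_sub_sq_real, empVar, ← mul_assoc, mul_one_div_cancel hn1, one_mul,
    Finset.sum_sub_distrib, ← Finset.mul_sum, h1]
  field_simp
  ring

end EmpiricalVariance

/-! ### Typical samples -/

section GoodSample

variable {𝒳 : Type*} [MeasurableSpace 𝒳] (g : 𝒳 → 𝒳 → ℝ) (H : Type*) [NormedAddCommGroup H]
  [InnerProductSpace ℝ H] [CompleteSpace H] [RKHS ℝ H 𝒳 ℝ]

/-- The sample `x` of the distribution `ν` is typical at level `L`: the sums of the centred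
features and of the centred squared distances to the embedding, which are bounded by
`√(2 g̃)` and `2 g̃`, satisfy Bernstein's bound with exponent `L`. -/
def IsTypical (ν : Measure 𝒳) (L : ℝ) {n : ℕ} (x : Fin n → 𝒳) : Prop :=
  ‖∑ t, (featureMap H (x t) - kme H ν)‖ ≤
      Real.sqrt (2 * n * rkhsVar H ν * L) + Real.sqrt (2 * kernelRange g) * L / 3 ∧
  |∑ t, (‖featureMap H (x t) - kme H ν‖ ^ 2 - rkhsVar H ν)| ≤
      Real.sqrt (2 * n * (2 * kernelRange g * rkhsVar H ν) * L) + 2 * kernelRange g * L / 3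

end GoodSample

section

variable {𝒳 : Type*} [AddGroup 𝒳] [TopologicalSpace 𝒳] [TopologicalSpace.SeparableSpace 𝒳]
  [MeasurableSpace 𝒳] [BorelSpace 𝒳] {g : 𝒳 → 𝒳 → ℝ} {H : Type*} [NormedAddCommGroup H]
  [InnerProductSpace ℝ H] [CompleteSpace H] [RKHS ℝ H 𝒳 ℝ]

theorem measureReal_not_isTypical_le (hH : HasKernel H g) (hti : IsTranslationInvariant g)
    (hg : Continuous fun p : 𝒳 × 𝒳 => g p.1 p.2) {ν : Measure 𝒳} [IsProbabilityMeasure ν]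
    {L : ℝ} (hL : 0 ≤ L) {Ω : Type*} [MeasurableSpace Ω] {P : Measure Ω} [IsProbabilityMeasure P]
    {n : ℕ} {Y : Fin n → Ω → 𝒳} (hY : ∀ t, Measurable (Y t)) (hlaw : ∀ t, P.map (Y t) = ν)
    (hind : iIndepFun Y P) :
    P.real {ω | ¬ IsTypical g H ν L fun t => Y t ω} ≤ 4 * Real.exp (-L) := by
  have hr := kernelRange_nonneg hH hti
  have hsm := (stronglyMeasurable_featureMap hH hg).sub
    (stronglyMeasurable_const (b := kme H ν))
  have hint := integrable_sq_norm_featureMap_sub_kme ν hH hti hg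
  have hV := rkhsVar_nonneg (H := H) ν
  have h1 := measureReal_norm_sum_gt_le (f := fun x => featureMap H x - kme H ν) hsm
    (Real.sqrt_nonneg (2 * kernelRange g)) (norm_featureMap_sub_kme_le ν hH hti hg)
    (integral_featureMap_sub_kme ν hH hti hg) (V := rkhsVar H ν) le_rfl hL hY hlaw hind
  have h2 := measureReal_norm_sum_gt_le
    (f := fun x => ‖featureMap H x - kme H ν‖ ^ 2 - rkhsVar H ν)
    ((hsm.norm.pow 2).sub stronglyMeasurable_const)
    (M := 2 * kernelRange g) (by positivity)
    (fun x => by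
      have h3 := sq_norm_featureMap_sub_kme_le ν hH hti hg x
      have h4 := rkhsVar_le ν hH hti hg
      rw [Real.norm_eq_abs, abs_le]
      constructor <;> nlinarith [sq_nonneg ‖featureMap H x - kme H ν‖])
    (by rw [integral_sub hint (integrable_const _), ← rkhsVar]; simp)
    (V := 2 * kernelRange g * rkhsVar H ν)
    (by
      -- `𝔼 (Z - 𝔼 Z)² ≤ 𝔼 Z² ≤ b 𝔼 Z` for a variable `Z` with values in `[0, b]`
      have hpt : ∀ x, ‖‖featureMap H x - kme H ν‖ ^ 2 - rkhsVar H ν‖ ^ 2 ≤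
          (2 * kernelRange g - 2 * rkhsVar H ν) * ‖featureMap H x - kme H ν‖ ^ 2 +
            rkhsVar H ν ^ 2 := fun x => by
        rw [Real.norm_eq_abs, sq_abs]
        have h3 := sq_norm_featureMap_sub_kme_le ν hH hti hg x
        nlinarith [sq_nonneg ‖featureMap H x - kme H ν‖]
      calc _ ≤ ∫ x, ((2 * kernelRange g - 2 * rkhsVar H ν) * ‖featureMap H x - kme H ν‖ ^ 2 +
            rkhsVar H ν ^ 2) ∂ν :=
            integral_mono_of_nonneg (Filter.Eventually.of_forall fun x => by positivity)
              ((hint.const_mul _).add (integrable_const _)) (Filter.Eventually.of_forall hpt)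
        _ = 2 * kernelRange g * rkhsVar H ν - rkhsVar H ν ^ 2 := by
            rw [integral_add (hint.const_mul _) (integrable_const _), integral_const_mul,
              ← rkhsVar]
            simp
            ring
        _ ≤ _ := by nlinarith) hL hY hlaw hind
  refine (measureReal_mono (s₂ := {ω | _ < _} ∪ {ω | _ < _}) fun ω hω => ?_).trans
    ((measureReal_union_le _ _).trans ((add_le_add h1 h2).trans_eq (by ring)))
  rw [Set.mem_ofPred_eq, IsTypical, not_and_or, not_le, not_le] at hω
  exact hω

/-- The bounds on the deviations of the empirical mean and variance that hold on a typical
sample, in terms of `q = √(L / n)`. -/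
theorem IsTypical.bounds (hH : HasKernel H g) (hti : IsTranslationInvariant g)
    (hg : Continuous fun p : 𝒳 × 𝒳 => g p.1 p.2) {ν : Measure 𝒳} [IsProbabilityMeasure ν]
    {L : ℝ} (hL : 2 ≤ L) {n : ℕ} (hn : 2 ≤ n) {x : Fin n → 𝒳} (hx : IsTypical g H ν L x) :
    ‖empKME H x - kme H ν‖ ≤ Real.sqrt 2 * Real.sqrt (rkhsVar H ν) * Real.sqrt (L / n) +
        Real.sqrt (2 * kernelRange g) * Real.sqrt (L / n) ^ 2 / 3 ∧
    ∃ W : ℝ, |W - Real.sqrt (rkhsVar H ν) ^ 2| ≤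
        Real.sqrt 2 * Real.sqrt (2 * kernelRange g) * Real.sqrt (rkhsVar H ν) *
          Real.sqrt (L / n) + (Real.sqrt (2 * kernelRange g) * Real.sqrt (L / n)) ^ 2 / 3 ∧
      W - ‖empKME H x - kme H ν‖ ^ 2 ≤ Real.sqrt (empVar g x) ^ 2 ∧
      Real.sqrt (empVar g x) ^ 2 ≤
        W + (Real.sqrt (2 * kernelRange g) * Real.sqrt (L / n)) ^ 2 := by
  have hr := kernelRange_nonneg hH hti
  have hV := rkhsVar_nonneg (H := H) ν
  have hn' : (2 : ℝ) ≤ n := by exact_mod_cast hn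
  have hn0 : (0 : ℝ) < n := by linarith
  have hq2 : Real.sqrt (L / n) ^ 2 = L / n := Real.sq_sqrt (by positivity)
  have hm2 : Real.sqrt (2 * kernelRange g) ^ 2 = 2 * kernelRange g := Real.sq_sqrt (by positivity)
  have hx2 : Real.sqrt (rkhsVar H ν) ^ 2 = rkhsVar H ν := Real.sq_sqrt hV
  have hs : ∀ A : ℝ, 0 ≤ A → Real.sqrt (2 * n * A * L) / n =
      Real.sqrt 2 * Real.sqrt A * Real.sqrt (L / n) := fun A hA => by
    rw [← Real.sqrt_mul (by norm_num), ← Real.sqrt_mul (by positivity), div_eq_iff hn0.ne',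
      ← Real.sqrt_sq hn0.le, ← Real.sqrt_mul (by positivity), Real.sqrt_sq hn0.le]
    congr 1
    field_simp
  have he : ‖empKME H x - kme H ν‖ = ‖∑ t, (featureMap H (x t) - kme H ν)‖ / n := by
    rw [empKME_sub (by omega), norm_smul, Real.norm_of_nonneg (by positivity)]
    ring
  have hV2 := sub_one_mul_empVar hH hn x (kme H ν)
  obtain ⟨h1, h2⟩ := hx
  set e := ‖empKME H x - kme H ν‖
  set S := ∑ t, ‖featureMap H (x t) - kme H ν‖ ^ 2 with hS
  have hSW : ∑ t, (‖featureMap H (x t) - kme H ν‖ ^ 2 - rkhsVar H ν) =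
      n * (S / n - rkhsVar H ν) := by
    rw [Finset.sum_sub_distrib, ← hS]
    simp
    field_simp
  have hSle : S ≤ n * (2 * kernelRange g) := by
    refine (Finset.sum_le_sum fun t _ =>
      sq_norm_featureMap_sub_kme_le ν hH hti hg (x t)).trans ?_
    simp
  have hSn : S = n * (S / n) := by field_simp
  have hS0 : 0 ≤ S / n := by positivity
  have hWle : S / n ≤ 2 * kernelRange g := by rwa [div_le_iff₀' hn0]
  have hee : e ^ 2 ≤ S / n := by
    -- Cauchy–Schwarz: the norm of the average is at most the quadratic mean of the norms
    have h3 : ‖∑ t, (featureMap H (x t) - kme H ν)‖ ^ 2 ≤ n * S := by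
      calc _ ≤ (∑ t, ‖featureMap H (x t) - kme H ν‖) ^ 2 := by
            gcongr
            exact norm_sum_le _ _
        _ ≤ _ := by simpa using sq_sum_le_card_mul_sum_sq (s := (Finset.univ : Finset (Fin n)))
                      (f := fun t => ‖featureMap H (x t) - kme H ν‖)
    rw [he, div_pow, div_le_div_iff₀ (by positivity) hn0]
    nlinarith
  have hVW : ((n : ℝ) - 1) * empVar g x = n * (S / n - e ^ 2) := by
    rw [hV2]; linarith
  have hV0 : 0 ≤ empVar g x := by
    have : 0 ≤ ((n : ℝ) - 1) * empVar g x := by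
      rw [hVW]; exact mul_nonneg hn0.le (by linarith)
    exact nonneg_of_mul_nonneg_right this (by linarith)
  rw [Real.sq_sqrt hV0, hx2, mul_pow, hm2, hq2]
  refine ⟨?_, S / n, ?_, ?_, ?_⟩
  · rw [he, ← hs _ hV, div_le_iff₀ hn0]
    refine h1.trans_eq ?_
    field_simp
  · rw [hSW, abs_mul, abs_of_pos hn0, ← le_div_iff₀' hn0, add_div, hs _ (by positivity),
      Real.sqrt_mul (by positivity)] at h2
    refine h2.trans_eq ?_
    ring
  · nlinarith
  · have h3 : (2 * kernelRange g) * n ≤ ((n : ℝ) - 1) * (2 * kernelRange g * L) := by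
      have h4 : (n : ℝ) ≤ (n - 1) * L := by nlinarith
      nlinarith
    have h5 : ((n : ℝ) - 1) * empVar g x ≤
        (n - 1) * (S / n + 2 * kernelRange g * (L / n)) := by
      have h6 : S / n ≤ (n - 1) * (2 * kernelRange g * (L / n)) := by
        refine hWle.trans ?_
        rw [← mul_div_assoc, ← mul_div_assoc, le_div_iff₀ hn0]
        exact h3
      nlinarith [sq_nonneg e]
    exact le_of_mul_le_mul_left h5 (by linarith)

/-- The contribution of one sample of size `n` to the rejection threshold, at level
`L = log (8 (N² - N) / δ')`. -/
def testWidth (g : 𝒳 → 𝒳 → ℝ) (L : ℝ) {n : ℕ} (x : Fin n → 𝒳) : ℝ :=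
  Real.sqrt (empVar g x) * Real.sqrt (2 * (L / n)) +
    16 / 3 * Real.sqrt (kernelRange g) * (L / n)

omit [AddGroup 𝒳] [TopologicalSpace 𝒳] [TopologicalSpace.SeparableSpace 𝒳]
  [MeasurableSpace 𝒳] [BorelSpace 𝒳] in
theorem threshold_eq (N : ℕ) (δ' : ℝ) {n : ℕ} (x y : Fin n → 𝒳) :
    threshold g N δ' x y = testWidth g (logTerm N δ') x + testWidth g (logTerm N δ') y := by
  rw [threshold, testWidth, testWidth]
  ring

omit [AddGroup 𝒳] [TopologicalSpace 𝒳] [TopologicalSpace.SeparableSpace 𝒳]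
  [MeasurableSpace 𝒳] [BorelSpace 𝒳] in
theorem testWidth_eq {L : ℝ} (hL : 0 ≤ L) {n : ℕ} (x : Fin n → 𝒳) :
    testWidth g L x = Real.sqrt 2 * Real.sqrt (empVar g x) * Real.sqrt (L / n) +
      8 / 3 * Real.sqrt 2 * Real.sqrt (2 * kernelRange g) * Real.sqrt (L / n) ^ 2 := by
  have h2 : Real.sqrt 2 * Real.sqrt 2 = 2 := Real.mul_self_sqrt (by norm_num)
  rw [testWidth, Real.sqrt_mul (by norm_num), Real.sqrt_mul (by norm_num),
    Real.sq_sqrt (by positivity)]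
  linear_combination (-(8 / 3) * Real.sqrt (kernelRange g) * (L / n)) * h2

/-- The true standard deviation `x` exceeds the empirical one `v` by at most a multiple of
`m q`, where `q = √(L / n)`, `m²` bounds the squared distances to the true mean, `W` is their
average over the sample, and `e` is the error of the empirical mean. If `m q` is small compared
with `x`, then `e²` is at most a multiple of `m q x`. The constant `12 / 5` leaves room for the
last term of the threshold: `12 / 5 * √2 + 1 / 3 ≤ 8 / 3 * √2`. -/
theorem le_sd_add {x v q m e W : ℝ} (hx : 0 ≤ x) (hv : 0 ≤ v) (hq : 0 ≤ q) (hm : 0 ≤ m)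
    (he0 : 0 ≤ e) (hxm : Real.sqrt 2 * x ≤ m) (he : e ≤ Real.sqrt 2 * x * q + m * q ^ 2 / 3)
    (hW : |W - x ^ 2| ≤ Real.sqrt 2 * m * x * q + (m * q) ^ 2 / 3) (hv2 : W - e ^ 2 ≤ v ^ 2) :
    x ≤ v + 12 / 5 * (m * q) := by
  by_contra! h
  have hs0 : 0 < Real.sqrt 2 := by positivity
  have hs2 : Real.sqrt 2 ^ 2 = 2 := Real.sq_sqrt (by norm_num)
  set s := Real.sqrt 2
  have hs1 : s ≤ 1.415 := by
    by_contra! h1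
    nlinarith
  have hs1' : 1.414 ≤ s := by
    by_contra! h1
    nlinarith
  set a := m * q with ha
  have ha0 : 0 ≤ a := by positivity
  have hax : 12 / 5 * a ≤ x := by linarith
  have hqx : s * (q * x) ≤ a := by nlinarith
  have hxpos : 0 < x := by
    rcases hx.eq_or_lt with h0 | h0
    · subst h0; linarith
    · exact h0
  have hqs : 12 / 5 * s * q ≤ 1 := by
    have : x * (12 / 5 * s * q) ≤ x * 1 := by nlinarith
    exact le_of_mul_le_mul_left this hxpos
  have hq3 : q ≤ 0.295 := by nlinarith
  have he1 : e ≤ 1.555 * (q * x) := by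
    have h1 : m * q ^ 2 / 3 ≤ 5 / 36 * (q * x) := by
      have : m * q ^ 2 = q * a := by rw [ha]; ring
      rw [this]
      nlinarith
    have h2 : s * x * q ≤ 1.415 * (q * x) := by
      have : s * x * q = s * (q * x) := by ring
      rw [this]
      gcongr
    nlinarith [mul_nonneg hq hx]
  have hqx0 : 0 ≤ q * x := by positivity
  have hqxa : q * x ≤ 0.7073 * a := by nlinarith
  have he2 : e ^ 2 ≤ 0.505 * (a * x) := by
    have h1 : e ^ 2 ≤ (1.555 * (q * x)) ^ 2 := by gcongr
    have h2 : (q * x) * (q * x) ≤ (0.295 * x) * (0.7073 * a) := by gcongr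
    nlinarith [mul_nonneg ha0 hx]
  have hW1 := (abs_le.1 hW).1
  have h3 : s * m * x * q ≤ 1.415 * (a * x) := by
    have : s * m * x * q = s * (a * x) := by rw [ha]; ring
    rw [this]
    gcongr
  have h4 : a ^ 2 / 3 ≤ 5 / 36 * (a * x) := by nlinarith
  have h5 : x * (x - 12 / 5 * a) ≤ v ^ 2 := by nlinarith [mul_nonneg ha0 hx]
  have h6 : v < x - 12 / 5 * a := by linarith
  nlinarith

theorem sd_le_add {x v q m W : ℝ} (hx : 0 ≤ x) (hq : 0 ≤ q) (hm : 0 ≤ m)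
    (hW : |W - x ^ 2| ≤ Real.sqrt 2 * m * x * q + (m * q) ^ 2 / 3)
    (hv2 : v ^ 2 ≤ W + (m * q) ^ 2) : v ≤ x + 6 / 5 * (m * q) := by
  refine le_of_sq_le_sq ?_ (by positivity)
  have hs1 : Real.sqrt 2 ≤ 1.415 := Real.sqrt_le_iff.2 ⟨by norm_num, by norm_num⟩
  have hW1 := (abs_le.1 hW).2
  have h3 : Real.sqrt 2 * m * x * q ≤ 1.415 * ((m * q) * x) := by
    have : Real.sqrt 2 * m * x * q = Real.sqrt 2 * ((m * q) * x) := by ring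
    rw [this]
    gcongr
  have h4 : 0 ≤ (m * q) * x := by positivity
  nlinarith

/-- On a typical sample, half the rejection threshold bounds the error of the empirical
embedding. -/
theorem IsTypical.norm_empKME_sub_le (hH : HasKernel H g) (hti : IsTranslationInvariant g)
    (hg : Continuous fun p : 𝒳 × 𝒳 => g p.1 p.2) {ν : Measure 𝒳} [IsProbabilityMeasure ν]
    {L : ℝ} (hL : 2 ≤ L) {n : ℕ} (hn : 2 ≤ n) {x : Fin n → 𝒳} (hx : IsTypical g H ν L x) :
    ‖empKME H x - kme H ν‖ ≤ testWidth g L x := by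
  obtain ⟨he, W, hW, hv, -⟩ := hx.bounds hH hti hg hL hn
  have hV := rkhsVar_le ν hH hti hg
  have hxm : Real.sqrt 2 * Real.sqrt (rkhsVar H ν) ≤ Real.sqrt (2 * kernelRange g) := by
    rw [← Real.sqrt_mul (by norm_num)]
    gcongr
  have h := le_sd_add (Real.sqrt_nonneg _) (Real.sqrt_nonneg _) (Real.sqrt_nonneg _)
    (Real.sqrt_nonneg _) (norm_nonneg _) hxm he hW hv
  rw [testWidth_eq (by linarith)]
  have hs1 : 1.4 ≤ Real.sqrt 2 := Real.le_sqrt_of_sq_le (by norm_num)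
  set q := Real.sqrt (L / n)
  set m := Real.sqrt (2 * kernelRange g)
  have hq : 0 ≤ q := Real.sqrt_nonneg _
  have hm : 0 ≤ m := Real.sqrt_nonneg _
  have h1 : Real.sqrt 2 * Real.sqrt (rkhsVar H ν) * q ≤
      Real.sqrt 2 * (Real.sqrt (empVar g x) + 12 / 5 * (m * q)) * q := by gcongr
  have h2 : 1.4 * (m * q ^ 2) ≤ Real.sqrt 2 * (m * q ^ 2) := by gcongr
  nlinarith [mul_nonneg hm (sq_nonneg q)]

/-- On a typical sample, if `L / n` is small compared with the squared signal-to-noise ratio for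
a distance `Δ`, then the test width and the error of the empirical embedding together are less
than `Δ / 2`. -/
theorem IsTypical.testWidth_add_norm_lt (hH : HasKernel H g) (hti : IsTranslationInvariant g)
    (hg : Continuous fun p : 𝒳 × 𝒳 => g p.1 p.2) {ν : Measure 𝒳} [IsProbabilityMeasure ν]
    {L : ℝ} (hL : 2 ≤ L) {n : ℕ} (hn : 2 ≤ n) {x : Fin n → 𝒳} (hx : IsTypical g H ν L x)
    {Δ : ℝ} (hΔ : 0 < Δ) (hΔV : 128 * (L / n) * rkhsVar H ν ≤ Δ ^ 2)
    (hΔg : 64 * (L / n) * Real.sqrt (kernelSup g) ≤ Δ) :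
    testWidth g L x + ‖empKME H x - kme H ν‖ < Δ / 2 := by
  obtain ⟨he, W, hW, -, hv⟩ := hx.bounds hH hti hg hL hn
  have h := sd_le_add (Real.sqrt_nonneg _) (Real.sqrt_nonneg _) (Real.sqrt_nonneg _) hW hv
  have hV := rkhsVar_nonneg (H := H) ν
  have hLn : 0 ≤ L / n := by positivity
  have hm2 : Real.sqrt (2 * kernelRange g) ≤ 2 * Real.sqrt (kernelSup g) := by
    have h0 : 0 ≤ kernelSup g := by
      have := kernelRange_nonneg hH hti
      have := kernelRange_le hH hti
      linarith
    refine Real.sqrt_le_iff.2 ⟨by positivity, ?_⟩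
    rw [mul_pow, Real.sq_sqrt h0]
    linarith [kernelRange_le hH hti]
  rw [testWidth_eq (by linarith)]
  have hs2 : Real.sqrt 2 ^ 2 = 2 := Real.sq_sqrt (by norm_num)
  have hx2 : Real.sqrt (rkhsVar H ν) ^ 2 = rkhsVar H ν := Real.sq_sqrt hV
  have hq2 : Real.sqrt (L / n) ^ 2 = L / n := Real.sq_sqrt hLn
  have hs1 : Real.sqrt 2 ≤ 1.415 := Real.sqrt_le_iff.2 ⟨by norm_num, by norm_num⟩
  have h1 : Real.sqrt 2 * Real.sqrt (rkhsVar H ν) * Real.sqrt (L / n) ≤ Δ / 8 := by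
    refine le_of_sq_le_sq ?_ (by positivity)
    rw [mul_pow, mul_pow, hs2, hx2, hq2]
    linarith
  set q := Real.sqrt (L / n)
  set m := Real.sqrt (2 * kernelRange g)
  have hq : 0 ≤ q := Real.sqrt_nonneg _
  have hm : 0 ≤ m := Real.sqrt_nonneg _
  have h2 : m * q ^ 2 ≤ Δ / 32 := by
    rw [hq2]
    nlinarith
  have h3 : Real.sqrt 2 * Real.sqrt (empVar g x) * q ≤
      Real.sqrt 2 * (Real.sqrt (rkhsVar H ν) + 6 / 5 * (m * q)) * q := by gcongr
  have h4 : Real.sqrt 2 * (m * q ^ 2) ≤ 1.415 * (m * q ^ 2) := by gcongr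
  nlinarith [mul_nonneg hm (sq_nonneg q)]

end

/-! ### Sample sizes and confidence levels -/

section Schedule

variable {N : ℕ} {δ : ℝ} {k : ℕ}

theorem two_le_sq_sub_self (hN : 2 ≤ N) : (2 : ℝ) ≤ (N : ℝ) ^ 2 - N := by
  have : (2 : ℝ) ≤ N := by exact_mod_cast hN
  nlinarith

theorem logTerm_confidence (N : ℕ) (δ : ℝ) (k : ℕ) :
    logTerm N (confidence δ k) = Real.log (32 * ((N : ℝ) ^ 2 - N) * (k : ℝ) ^ 2 / δ) := by
  rw [logTerm, confidence, div_div_eq_mul_div]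
  ring_nf

theorem two_le_logTerm (hN : 2 ≤ N) (hδ0 : 0 < δ) (hδ1 : δ ≤ 1) (hk : 1 ≤ k) :
    2 ≤ logTerm N (confidence δ k) := by
  have hN' := two_le_sq_sub_self hN
  have hk' : (1 : ℝ) ≤ (k : ℝ) ^ 2 := one_le_pow₀ (by exact_mod_cast hk)
  have h64 : (64 : ℝ) ≤ 32 * ((N : ℝ) ^ 2 - N) * (k : ℝ) ^ 2 / δ := by
    rw [le_div_iff₀ hδ0]
    nlinarith
  rw [logTerm_confidence, Real.le_log_iff_exp_le (by linarith)]
  have h1 : Real.exp 2 = Real.exp 1 ^ 2 := by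
    rw [← Real.exp_nat_mul]; norm_num
  have h2 : Real.exp 1 < 8 := Real.exp_one_lt_d9.trans (by norm_num)
  rw [h1]
  nlinarith [Real.exp_pos 1]

theorem logTerm_mono (hN : 2 ≤ N) (hδ0 : 0 < δ) (hk : 1 ≤ k) {l : ℕ} (hkl : k ≤ l) :
    logTerm N (confidence δ k) ≤ logTerm N (confidence δ l) := by
  have hN' := two_le_sq_sub_self hN
  rw [logTerm_confidence, logTerm_confidence]
  have hk' : (0 : ℝ) < k := by exact_mod_cast hk
  apply Real.log_le_log
  · have : 0 < (N : ℝ) ^ 2 - N := by linarith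
    positivity
  · gcongr

theorem exp_neg_logTerm (hN : 2 ≤ N) (hδ0 : 0 < δ) (hk : 1 ≤ k) :
    Real.exp (-logTerm N (confidence δ k)) = δ / (32 * ((N : ℝ) ^ 2 - N) * (k : ℝ) ^ 2) := by
  have hN' := two_le_sq_sub_self hN
  have hk' : (0 : ℝ) < k := by exact_mod_cast hk
  have : 0 < (N : ℝ) ^ 2 - N := by linarith
  rw [logTerm_confidence, Real.exp_neg, Real.exp_log (by positivity), inv_div]

theorem le_perArmBudget (N : ℕ) (δ : ℝ) (k : ℕ) :
    2 ^ k * logTerm N (confidence δ k) ≤ perArmBudget N δ k :=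
  Nat.le_ceil _

theorem two_le_perArmBudget (hN : 2 ≤ N) (hδ0 : 0 < δ) (hδ1 : δ ≤ 1) (hk : 1 ≤ k) :
    2 ≤ perArmBudget N δ k := by
  have h1 := le_perArmBudget N δ k
  have h2 := two_le_logTerm hN hδ0 hδ1 hk
  have h3 : (1 : ℝ) ≤ 2 ^ k := one_le_pow₀ (by norm_num)
  have h4 : (2 : ℝ) ≤ perArmBudget N δ k := by nlinarith
  exact_mod_cast h4

theorem two_pow_mul_div_le (hN : 2 ≤ N) (hδ0 : 0 < δ) (hδ1 : δ ≤ 1) (hk : 1 ≤ k) :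
    2 ^ k * (logTerm N (confidence δ k) / perArmBudget N δ k) ≤ 1 := by
  have h1 : 0 < perArmBudget N δ k := by
    have := two_le_perArmBudget hN hδ0 hδ1 hk
    omega
  rw [← mul_div_assoc, div_le_one (by exact_mod_cast h1)]
  exact le_perArmBudget N δ k

theorem perArmBudget_le (hN : 2 ≤ N) (hδ0 : 0 < δ) (hδ1 : δ ≤ 1) (hk : 1 ≤ k) :
    (perArmBudget N δ k : ℝ) ≤ 2 ^ k * logTerm N (confidence δ k) + 1 := by
  have h2 := two_le_logTerm hN hδ0 hδ1 hk
  exact (Nat.ceil_lt_add_one (by positivity)).le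

theorem sum_perArmBudget_le (hN : 2 ≤ N) (hδ0 : 0 < δ) (hδ1 : δ ≤ 1) (hk : 1 ≤ k) :
    ((∑ l ∈ Finset.Icc 1 k, N * perArmBudget N δ l : ℕ) : ℝ) ≤
      4 * N * 2 ^ k * logTerm N (confidence δ k) := by
  have hL := two_le_logTerm hN hδ0 hδ1 hk
  set L := logTerm N (confidence δ k)
  have h1 : ∀ l ∈ Finset.Icc 1 k, (N : ℝ) * (perArmBudget N δ l : ℝ) ≤
      N * (2 ^ l * L + 1) := fun l hl => by
    obtain ⟨hl1, hl2⟩ := Finset.mem_Icc.1 hl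
    gcongr
    refine (perArmBudget_le hN hδ0 hδ1 hl1).trans ?_
    gcongr
    exact logTerm_mono hN hδ0 hl1 hl2
  have h2 : ∑ l ∈ Finset.Icc 1 k, (2 : ℝ) ^ l ≤ 2 * 2 ^ k := by
    calc ∑ l ∈ Finset.Icc 1 k, (2 : ℝ) ^ l ≤ ∑ l ∈ Finset.range (k + 1), (2 : ℝ) ^ l :=
          Finset.sum_le_sum_of_subset_of_nonneg
            (fun l hl => by
              have := Finset.mem_Icc.1 hl
              exact Finset.mem_range.2 (by omega))
            fun _ _ _ => by positivity
      _ = 2 * 2 ^ k - 1 := by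
          rw [geom_sum_eq (by norm_num), pow_succ]; ring
      _ ≤ _ := by linarith
  have h3 : (k : ℝ) ≤ 2 ^ k := by exact_mod_cast Nat.lt_two_pow_self.le
  push_cast
  calc _ ≤ ∑ l ∈ Finset.Icc 1 k, (N : ℝ) * (2 ^ l * L + 1) := Finset.sum_le_sum h1
    _ = N * ((∑ l ∈ Finset.Icc 1 k, (2 : ℝ) ^ l) * L + k) := by
        rw [← Finset.mul_sum, Finset.sum_add_distrib, Finset.sum_mul]
        simp
    _ ≤ N * (2 * 2 ^ k * L + 2 ^ k * L) := by
        gcongr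
        nlinarith
    _ ≤ _ := by
        have : 0 ≤ (N : ℝ) * 2 ^ k * L := by positivity
        linarith

end Schedule

/-! ### The signal-to-noise ratio -/

section SignalToNoise

theorem invSnr_le_two_pow {s : ℝ≥0∞} {k : ℕ} (hk : kStar s ≤ k) : invSnr s ≤ 2 ^ k := by
  rcases (ENNReal.toReal_nonneg (a := 128 / s)).eq_or_lt with h | h
  · rw [invSnr, ← h]; positivity
  · have h1 : ⌈Real.logb 2 (invSnr s)⌉ ≤ (k : ℤ) := (le_max_left _ _).trans hk
    have h2 : Real.logb 2 (invSnr s) ≤ k := by exact_mod_cast Int.ceil_le.1 h1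
    exact_mod_cast (Real.logb_le_iff_le_rpow (by norm_num) h).1 h2

theorem two_pow_kStar_le {s : ℝ≥0∞} {k : ℕ} (hk : kStar s = k) :
    (2 : ℝ) ^ k ≤ 2 * max (invSnr s) 1 := by
  rw [kStar] at hk
  rcases le_total ⌈Real.logb 2 (invSnr s)⌉ 1 with h | h
  · rw [max_eq_right h] at hk
    have : k = 1 := by exact_mod_cast hk.symm
    rw [this]
    have := le_max_right (invSnr s) 1
    linarith
  · rw [max_eq_left h] at hk
    have hpos : 0 < invSnr s := by
      rcases (ENNReal.toReal_nonneg (a := 128 / s)).eq_or_lt with h0 | h0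
      · rw [invSnr, ← h0] at h
        simp at h
      · exact h0
    have h1 : (k : ℝ) < Real.logb 2 (invSnr s) + 1 := by
      have := Int.ceil_lt_add_one (Real.logb 2 (invSnr s))
      rw [hk] at this
      exact_mod_cast this
    have h2 : (k : ℝ) - 1 < Real.logb 2 (invSnr s) := by linarith
    rw [Real.lt_logb_iff_rpow_lt (by norm_num) hpos, Real.rpow_sub_one (by norm_num),
      Real.rpow_natCast] at h2
    have := le_max_left (invSnr s) 1
    linarith

theorem mul_le_of_le_ofReal_div {s : ℝ≥0∞} (hs : s ≠ 0) {a b u : ℝ} (ha : 0 ≤ a) (hb : 0 ≤ b)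
    (hsab : s ≤ ENNReal.ofReal a / ENNReal.ofReal b) (hsu : invSnr s * u ≤ 1) :
    128 * u * b ≤ a := by
  rcases hb.eq_or_lt with rfl | hb
  · simpa using ha
  have hab : ENNReal.ofReal a / ENNReal.ofReal b = ENNReal.ofReal (a / b) :=
    (ENNReal.ofReal_div_of_pos hb).symm
  rw [hab] at hsab
  have hst : s ≠ ⊤ := ne_top_of_le_ne_top ENNReal.ofReal_ne_top hsab
  have hpos : 0 < s.toReal := ENNReal.toReal_pos hs hst
  have h1 : s.toReal ≤ a / b := ENNReal.toReal_le_of_le_ofReal (by positivity) hsab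
  have h2 : invSnr s = 128 / s.toReal := by simp [invSnr, ENNReal.toReal_div]
  rw [h2, div_mul_eq_mul_div, div_le_one hpos] at hsu
  rw [le_div_iff₀ hb] at h1
  nlinarith

variable {𝒳 : Type*} [MeasurableSpace 𝒳] {g : 𝒳 → 𝒳 → ℝ} {H : Type*} [NormedAddCommGroup H]
  [InnerProductSpace ℝ H] [CompleteSpace H] [RKHS ℝ H 𝒳 ℝ] {N : ℕ}
  {ν : Fin N → ProbabilityMeasure 𝒳}

theorem snrSq_ne_zero [Nonempty (Fin N)] : snrSq g H ν ≠ 0 := by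
  rw [snrSq]
  obtain ⟨i, hi⟩ := exists_eq_ciInf_of_finite (f := fun i : Fin N => ⨅ (j : Fin N)
    (_ : i ≠ j ∧ kme H (ν i : Measure 𝒳) ≠ kme H (ν j : Measure 𝒳)), min
      (ENNReal.ofReal (‖kme H (ν i : Measure 𝒳) - kme H (ν j : Measure 𝒳)‖ ^ 2) /
        ENNReal.ofReal (max (rkhsVar H (ν i : Measure 𝒳)) (rkhsVar H (ν j : Measure 𝒳))))
      (ENNReal.ofReal (2 * ‖kme H (ν i : Measure 𝒳) - kme H (ν j : Measure 𝒳)‖) /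
        ENNReal.ofReal (Real.sqrt (kernelSup g))))
  rw [← hi]
  obtain ⟨j, hj⟩ := exists_eq_ciInf_of_finite (f := fun j : Fin N => ⨅
    (_ : i ≠ j ∧ kme H (ν i : Measure 𝒳) ≠ kme H (ν j : Measure 𝒳)), min
      (ENNReal.ofReal (‖kme H (ν i : Measure 𝒳) - kme H (ν j : Measure 𝒳)‖ ^ 2) /
        ENNReal.ofReal (max (rkhsVar H (ν i : Measure 𝒳)) (rkhsVar H (ν j : Measure 𝒳))))
      (ENNReal.ofReal (2 * ‖kme H (ν i : Measure 𝒳) - kme H (ν j : Measure 𝒳)‖) /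
        ENNReal.ofReal (Real.sqrt (kernelSup g))))
  rw [← hj]
  by_cases h : i ≠ j ∧ kme H (ν i : Measure 𝒳) ≠ kme H (ν j : Measure 𝒳)
  · rw [iInf_pos h]
    have hΔ : 0 < ‖kme H (ν i : Measure 𝒳) - kme H (ν j : Measure 𝒳)‖ :=
      norm_pos_iff.2 (sub_ne_zero.2 h.2)
    exact (lt_min
      (ENNReal.div_pos (ENNReal.ofReal_pos.2 (by positivity)).ne' ENNReal.ofReal_ne_top)
      (ENNReal.div_pos (ENNReal.ofReal_pos.2 (by positivity)).ne' ENNReal.ofReal_ne_top)).ne'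
  · rw [iInf_neg h]
    exact ENNReal.top_ne_zero

theorem snrSq_le {i j : Fin N} (h : kme H (ν i : Measure 𝒳) ≠ kme H (ν j : Measure 𝒳)) :
    snrSq g H ν ≤ min
      (ENNReal.ofReal (‖kme H (ν i : Measure 𝒳) - kme H (ν j : Measure 𝒳)‖ ^ 2) /
        ENNReal.ofReal (max (rkhsVar H (ν i : Measure 𝒳)) (rkhsVar H (ν j : Measure 𝒳))))
      (ENNReal.ofReal (2 * ‖kme H (ν i : Measure 𝒳) - kme H (ν j : Measure 𝒳)‖) /
        ENNReal.ofReal (Real.sqrt (kernelSup g))) :=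
  iInf_le_of_le i (iInf_le_of_le j (iInf_le_of_le ⟨fun hij => h (by rw [hij]), h⟩ le_rfl))

end SignalToNoise

/-! ### Clusterings computed from typical samples -/

section Clustering

theorem setoid_eq_of_le_of_card_eq {α : Type*} [Finite α] {r s : Setoid α} (hrs : r ≤ s)
    (hcard : Nat.card (Quotient r) = Nat.card (Quotient s)) : r = s := by
  have hsurj : Function.Surjective (Quotient.map' (s₁ := r) (s₂ := s) id fun _ _ h => hrs h) := by
    rintro ⟨a⟩
    exact ⟨Quotient.mk r a, rfl⟩
  have hinj := ((Nat.bijective_iff_surjective_and_card _).2 ⟨hsurj, hcard⟩).1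
  refine le_antisymm hrs fun a b hab => Quotient.exact (hinj ?_)
  exact Quotient.sound hab

variable {𝒳 : Type*} [AddGroup 𝒳] [TopologicalSpace 𝒳] [TopologicalSpace.SeparableSpace 𝒳]
  [MeasurableSpace 𝒳] [BorelSpace 𝒳] {g : 𝒳 → 𝒳 → ℝ} {H : Type*} [NormedAddCommGroup H]
  [InnerProductSpace ℝ H] [CompleteSpace H] [RKHS ℝ H 𝒳 ℝ] {N : ℕ}
  {ν : Fin N → ProbabilityMeasure 𝒳}

/-- If the samples of two arms with the same embedding are typical, then the arms are joined by
an edge. -/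
theorem empMMD_le_threshold (hH : HasKernel H g) (hti : IsTranslationInvariant g)
    (hg : Continuous fun p : 𝒳 × 𝒳 => g p.1 p.2) {δ' : ℝ} (hL : 2 ≤ logTerm N δ') {n : ℕ}
    (hn : 2 ≤ n) {x : Fin N → Fin n → 𝒳}
    (hx : ∀ i, IsTypical g H (ν i : Measure 𝒳) (logTerm N δ') (x i)) {i j : Fin N}
    (hij : kme H (ν i : Measure 𝒳) = kme H (ν j : Measure 𝒳)) :
    empMMD g (x i) (x j) ≤ threshold g N δ' (x i) (x j) := by
  have h1 := (hx i).norm_empKME_sub_le hH hti hg hL hn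
  have h2 := (hx j).norm_empKME_sub_le hH hti hg hL hn
  rw [empMMD_eq_norm hH, threshold_eq]
  rw [← hij] at h2
  have h3 := norm_sub_le_norm_sub_add_norm_sub (empKME H (x j)) (kme H (ν i : Measure 𝒳))
    (empKME H (x i))
  rw [norm_sub_rev (kme H (ν i : Measure 𝒳))] at h3
  linarith

/-- If the samples of two arms with different embeddings are typical and large compared with the
inverse signal-to-noise ratio, then the arms are not joined by an edge. -/
theorem threshold_lt_empMMD (hH : HasKernel H g) (hti : IsTranslationInvariant g)
    (hg : Continuous fun p : 𝒳 × 𝒳 => g p.1 p.2) {δ' : ℝ} (hL : 2 ≤ logTerm N δ') {n : ℕ}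
    (hn : 2 ≤ n) (hs : invSnr (snrSq g H ν) * (logTerm N δ' / n) ≤ 1) {x : Fin N → Fin n → 𝒳}
    (hx : ∀ i, IsTypical g H (ν i : Measure 𝒳) (logTerm N δ') (x i)) {i j : Fin N}
    (hij : kme H (ν i : Measure 𝒳) ≠ kme H (ν j : Measure 𝒳)) :
    threshold g N δ' (x i) (x j) < empMMD g (x i) (x j) := by
  have : Nonempty (Fin N) := ⟨i⟩
  have hsle := snrSq_le (g := g) hij
  have hs0 := snrSq_ne_zero (g := g) (H := H) (ν := ν)
  have hu : 0 ≤ logTerm N δ' / n := by positivity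
  have hΔ : 0 < ‖kme H (ν i : Measure 𝒳) - kme H (ν j : Measure 𝒳)‖ :=
    norm_pos_iff.2 (sub_ne_zero.2 hij)
  have hVi := rkhsVar_nonneg (H := H) (ν i : Measure 𝒳)
  have hV := mul_le_of_le_ofReal_div hs0 (by positivity) (le_max_of_le_left hVi)
    (hsle.trans (min_le_left _ _)) hs
  have hG := mul_le_of_le_ofReal_div hs0 (by positivity) (Real.sqrt_nonneg _)
    (hsle.trans (min_le_right _ _)) hs
  set Δ := ‖kme H (ν i : Measure 𝒳) - kme H (ν j : Measure 𝒳)‖ with hΔdef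
  have hG' : 64 * (logTerm N δ' / n) * Real.sqrt (kernelSup g) ≤ Δ := by linarith
  have h1 := (hx i).testWidth_add_norm_lt hH hti hg hL hn hΔ
    ((mul_le_mul_of_nonneg_left (le_max_left _ _) (by positivity)).trans hV) hG'
  have h2 := (hx j).testWidth_add_norm_lt hH hti hg hL hn hΔ
    ((mul_le_mul_of_nonneg_left (le_max_right _ _) (by positivity)).trans hV) hG'
  rw [empMMD_eq_norm hH, threshold_eq]
  have h3 := norm_sub_le_norm_sub_add_norm_sub (kme H (ν i : Measure 𝒳)) (empKME H (x i))
    (kme H (ν j : Measure 𝒳))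
  have h4 := norm_sub_le_norm_sub_add_norm_sub (empKME H (x i)) (empKME H (x j))
    (kme H (ν j : Measure 𝒳))
  rw [norm_sub_rev (kme H (ν i : Measure 𝒳)) (empKME H (x i)), ← hΔdef] at h3
  rw [norm_sub_rev (empKME H (x i)) (empKME H (x j))] at h4
  linarith

theorem trueClustering_le_cluster (hH : HasKernel H g) (hti : IsTranslationInvariant g)
    (hg : Continuous fun p : 𝒳 × 𝒳 => g p.1 p.2) {δ' : ℝ} (hL : 2 ≤ logTerm N δ') {n : ℕ}
    (hn : 2 ≤ n) {x : Fin N → Fin n → 𝒳}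
    (hx : ∀ i, IsTypical g H (ν i : Measure 𝒳) (logTerm N δ') (x i)) :
    trueClustering H ν ≤ cluster g δ' x := by
  intro i j hij
  by_cases h : i = j
  · subst h
    exact SimpleGraph.Reachable.refl _
  · exact SimpleGraph.Adj.reachable ((SimpleGraph.fromRel_adj _ _ _).2
      ⟨h, Or.inl (empMMD_le_threshold hH hti hg hL hn hx hij)⟩)

theorem cluster_eq_trueClustering (hH : HasKernel H g) (hti : IsTranslationInvariant g)
    (hg : Continuous fun p : 𝒳 × 𝒳 => g p.1 p.2) {δ' : ℝ} (hL : 2 ≤ logTerm N δ') {n : ℕ}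
    (hn : 2 ≤ n) (hs : invSnr (snrSq g H ν) * (logTerm N δ' / n) ≤ 1) {x : Fin N → Fin n → 𝒳}
    (hx : ∀ i, IsTypical g H (ν i : Measure 𝒳) (logTerm N δ') (x i)) :
    cluster g δ' x = trueClustering H ν := by
  refine le_antisymm ?_ (trueClustering_le_cluster hH hti hg hL hn hx)
  have hadj : ∀ i j, (clusterGraph g δ' x).Adj i j →
      kme H (ν i : Measure 𝒳) = kme H (ν j : Measure 𝒳) := fun i j h => by
    by_contra hne
    rcases ((SimpleGraph.fromRel_adj _ _ _).1 h).2 with h1 | h1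
    · exact absurd h1 (threshold_lt_empMMD hH hti hg hL hn hs hx hne).not_ge
    · exact absurd h1 (threshold_lt_empMMD hH hti hg hL hn hs hx (Ne.symm hne)).not_ge
  rintro i j ⟨w⟩
  induction w with
  | nil => rfl
  | cons h _ ih => exact (hadj _ _ h).trans ih

omit [AddGroup 𝒳] [TopologicalSpace 𝒳] [TopologicalSpace.SeparableSpace 𝒳] [BorelSpace 𝒳] in
theorem isCorrect_trueClustering : IsCorrect H ν (trueClustering H ν) :=
  fun _ _ _ => Iff.rfl

end Clustering

/-! ### The iterations of the algorithm -/

section Iterations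

variable {𝒳 : Type*} [AddGroup 𝒳] [TopologicalSpace 𝒳] [TopologicalSpace.SeparableSpace 𝒳]
  [MeasurableSpace 𝒳] [BorelSpace 𝒳] {g : 𝒳 → 𝒳 → ℝ} {H : Type*} [NormedAddCommGroup H]
  [InnerProductSpace ℝ H] [CompleteSpace H] [RKHS ℝ H 𝒳 ℝ] {N : ℕ}
  {ν : Fin N → ProbabilityMeasure 𝒳} {K : ℕ} {δ : ℝ} {k : ℕ}

variable (g H ν δ) in
/-- All samples drawn in iteration `k` are typical. -/
def IsTypicalAt (x : Fin N → ℕ → 𝒳) (k : ℕ) : Prop :=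
  ∀ i, IsTypical g H (ν i : Measure 𝒳) (logTerm N (confidence δ k)) (iterSample δ x k i)

theorem IsTypicalAt.iterClustering_eq_of_kStar_le (hH : HasKernel H g)
    (hti : IsTranslationInvariant g) (hg : Continuous fun p : 𝒳 × 𝒳 => g p.1 p.2)
    (hN : 2 ≤ N) (hδ0 : 0 < δ) (hδ1 : δ ≤ 1) (hk : 1 ≤ k) {x : Fin N → ℕ → 𝒳}
    (hx : IsTypicalAt g H ν δ x k) (hks : kStar (snrSq g H ν) ≤ k) :
    iterClustering g δ x k = trueClustering H ν := by
  have hL := two_le_logTerm hN hδ0 hδ1 hk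
  refine cluster_eq_trueClustering hH hti hg hL (two_le_perArmBudget hN hδ0 hδ1 hk) ?_ hx
  refine le_trans ?_ (two_pow_mul_div_le hN hδ0 hδ1 hk)
  exact mul_le_mul_of_nonneg_right (invSnr_le_two_pow hks) (by positivity)

theorem IsTypicalAt.stopsAt (hH : HasKernel H g)
    (hti : IsTranslationInvariant g) (hg : Continuous fun p : 𝒳 × 𝒳 => g p.1 p.2)
    (hN : 2 ≤ N) (hK : numClusters (trueClustering H ν) = K) (hδ0 : 0 < δ) (hδ1 : δ ≤ 1)
    (hk : 1 ≤ k) {x : Fin N → ℕ → 𝒳}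
    (hx : IsTypicalAt g H ν δ x k) (hks : kStar (snrSq g H ν) ≤ k) :
    StopsAt g K δ x k :=
  ⟨hk, by rw [hx.iterClustering_eq_of_kStar_le hH hti hg hN hδ0 hδ1 hk hks, hK]⟩

/-- On a typical iteration the clustering is coarser than the true one, so it is the true one if
it has the right number of groups. -/
theorem IsTypicalAt.iterClustering_eq_of_stopsAt (hH : HasKernel H g)
    (hti : IsTranslationInvariant g) (hg : Continuous fun p : 𝒳 × 𝒳 => g p.1 p.2)
    (hN : 2 ≤ N) (hK : numClusters (trueClustering H ν) = K) (hδ0 : 0 < δ) (hδ1 : δ ≤ 1)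
    {x : Fin N → ℕ → 𝒳} (hx : IsTypicalAt g H ν δ x k) (hs : StopsAt g K δ x k) :
    iterClustering g δ x k = trueClustering H ν :=
  (setoid_eq_of_le_of_card_eq (trueClustering_le_cluster hH hti hg
    (two_le_logTerm hN hδ0 hδ1 hs.1) (two_le_perArmBudget hN hδ0 hδ1 hs.1) hx)
    (hK.trans hs.2.symm)).symm

omit [AddGroup 𝒳] [TopologicalSpace 𝒳] [TopologicalSpace.SeparableSpace 𝒳]
  [MeasurableSpace 𝒳] [BorelSpace 𝒳] in
theorem exists_budget_eq_of_stopsAt {x : Fin N → ℕ → 𝒳} (hs : StopsAt g K δ x k) :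
    ∃ τ : ℕ, budget g K δ x = τ ∧ τ ≤ ∑ l ∈ Finset.Icc 1 k, N * perArmBudget N δ l := by
  classical
  have h : ∃ k, StopsAt g K δ x k := ⟨k, hs⟩
  refine ⟨_, dif_pos h, Finset.sum_le_sum_of_subset (Finset.Icc_subset_Icc le_rfl ?_)⟩
  exact Nat.find_min' h hs

theorem exists_output_isCorrect (hH : HasKernel H g)
    (hti : IsTranslationInvariant g) (hg : Continuous fun p : 𝒳 × 𝒳 => g p.1 p.2)
    (hN : 2 ≤ N) (hK : numClusters (trueClustering H ν) = K) (hδ0 : 0 < δ) (hδ1 : δ ≤ 1)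
    {x : Fin N → ℕ → 𝒳} (hx : ∀ k, 1 ≤ k → IsTypicalAt g H ν δ x k)
    (hs : ∃ k, StopsAt g K δ x k) :
    ∃ C, output g K δ x = some C ∧ IsCorrect H ν C := by
  classical
  refine ⟨_, dif_pos hs, ?_⟩
  have h := Nat.find_spec hs
  have := (hx _ h.1).iterClustering_eq_of_stopsAt hH hti hg hN hK hδ0 hδ1 h
  convert isCorrect_trueClustering (H := H) (ν := ν)

variable {Ω : Type*} [MeasurableSpace Ω] {P : Measure Ω} [IsProbabilityMeasure P]
  {X : Fin N → ℕ → Ω → 𝒳}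

theorem measureReal_not_isTypicalAt_le (hH : HasKernel H g)
    (hti : IsTranslationInvariant g) (hg : Continuous fun p : 𝒳 × 𝒳 => g p.1 p.2)
    (hN : 2 ≤ N) (hδ0 : 0 < δ) (hδ1 : δ ≤ 1) (hk : 1 ≤ k)
    (hX_meas : ∀ i s, Measurable (X i s)) (hX_law : ∀ i s, P.map (X i s) = (ν i : Measure 𝒳))
    (hX_indep : iIndepFun (fun p : Fin N × ℕ => X p.1 p.2) P) :
    P.real {ω | ¬ IsTypicalAt g H ν δ (fun i s => X i s ω) k} ≤ δ / 8 * (1 / (k : ℝ) ^ 2) := by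
  have hL := two_le_logTerm hN hδ0 hδ1 hk
  have harm : ∀ i, P.real {ω | ¬ IsTypical g H (ν i : Measure 𝒳) (logTerm N (confidence δ k))
      (iterSample δ (fun i s => X i s ω) k i)} ≤
      4 * Real.exp (-logTerm N (confidence δ k)) := fun i => by
    have hind : iIndepFun (fun t : Fin (perArmBudget N δ k) => X i (pullsBefore N δ k + t)) P :=
      hX_indep.precomp (g := fun t : Fin (perArmBudget N δ k) => (i, pullsBefore N δ k + t))
        fun s t hst => by
          simp only [Prod.mk.injEq, true_and] at hst
          exact Fin.ext (by omega)
    exact measureReal_not_isTypical_le hH hti hg (by linarith)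
      (Y := fun t : Fin (perArmBudget N δ k) => X i (pullsBefore N δ k + t))
      (fun t => hX_meas _ _) (fun t => hX_law _ _) hind
  have hsub : {ω | ¬ IsTypicalAt g H ν δ (fun i s => X i s ω) k} ⊆
      ⋃ i, {ω | ¬ IsTypical g H (ν i : Measure 𝒳) (logTerm N (confidence δ k))
      (iterSample δ (fun i s => X i s ω) k i)} := fun ω hω => by
    rw [Set.mem_ofPred_eq, IsTypicalAt, not_forall] at hω
    exact Set.mem_iUnion.2 hω
  refine (measureReal_mono hsub).trans ((measureReal_iUnion_fintype_le _).trans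
    ((Finset.sum_le_sum fun i _ => harm i).trans ?_))
  rw [Finset.sum_const, Finset.card_univ, Fintype.card_fin, nsmul_eq_mul,
    exp_neg_logTerm hN hδ0 hk]
  have hN' : (2 : ℝ) ≤ N := by exact_mod_cast hN
  have hk' : (0 : ℝ) < k := by exact_mod_cast hk
  have hN1 : (0 : ℝ) < N - 1 := by linarith
  calc (N : ℝ) * (4 * (δ / (32 * ((N : ℝ) ^ 2 - N) * (k : ℝ) ^ 2)))
      = δ / 8 * (1 / (k : ℝ) ^ 2) / (N - 1) := by
        rw [show (N : ℝ) ^ 2 - N = N * (N - 1) by ring]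
        field_simp
        norm_num
    _ ≤ _ := div_le_self (by positivity) (by linarith)

theorem one_sub_le_measureReal {A B : Set Ω} {p : ℝ} (hB : P.real B ≤ p)
    (hAB : ∀ ω, ω ∉ B → ω ∈ A) : 1 - p ≤ P.real A := by
  have h : P.real Set.univ ≤ P.real (A ∪ B) := measureReal_mono fun ω _ => by
    by_cases h : ω ∈ B
    · exact Or.inr h
    · exact Or.inl (hAB ω h)
  have h2 := measureReal_union_le (μ := P) A B
  rw [probReal_univ] at h
  linarith

theorem measureReal_exists_not_isTypicalAt_le (hH : HasKernel H g)
    (hti : IsTranslationInvariant g) (hg : Continuous fun p : 𝒳 × 𝒳 => g p.1 p.2)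
    (hN : 2 ≤ N) (hδ0 : 0 < δ) (hδ1 : δ ≤ 1)
    (hX_meas : ∀ i s, Measurable (X i s)) (hX_law : ∀ i s, P.map (X i s) = (ν i : Measure 𝒳))
    (hX_indep : iIndepFun (fun p : Fin N × ℕ => X p.1 p.2) P) :
    P.real {ω | ∃ k, 1 ≤ k ∧ ¬ IsTypicalAt g H ν δ (fun i s => X i s ω) k} ≤ δ := by
  have hsum : HasSum (fun k : ℕ => δ / 8 * (1 / (k : ℝ) ^ 2)) (δ / 8 * (Real.pi ^ 2 / 6)) :=
    hasSum_zeta_two.mul_left _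
  have hle : P {ω | ∃ k, 1 ≤ k ∧ ¬ IsTypicalAt g H ν δ (fun i s => X i s ω) k} ≤
      ENNReal.ofReal (δ / 8 * (Real.pi ^ 2 / 6)) := by
    calc _ ≤ P (⋃ k : ℕ, {ω | 1 ≤ k ∧ ¬ IsTypicalAt g H ν δ (fun i s => X i s ω) k}) :=
          measure_mono fun ω hω => Set.mem_iUnion.2 hω
      _ ≤ ∑' k : ℕ, P {ω | 1 ≤ k ∧ ¬ IsTypicalAt g H ν δ (fun i s => X i s ω) k} :=
          measure_iUnion_le _
      _ ≤ ∑' k : ℕ, ENNReal.ofReal (δ / 8 * (1 / (k : ℝ) ^ 2)) := by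
          refine ENNReal.tsum_le_tsum fun k => ?_
          by_cases hk : 1 ≤ k
          · simp only [hk, true_and]
            rw [← ofReal_measureReal]
            exact ENNReal.ofReal_le_ofReal
              (measureReal_not_isTypicalAt_le hH hti hg hN hδ0 hδ1 hk hX_meas hX_law hX_indep)
          · simp [hk]
      _ = _ := by
          rw [← ENNReal.ofReal_tsum_of_nonneg (fun k => by positivity) hsum.summable,
            hsum.tsum_eq]
  refine (ENNReal.toReal_le_of_le_ofReal (by positivity) hle).trans ?_
  have h4 : Real.pi ^ 2 ≤ 16 := by nlinarith [Real.pi_pos, Real.pi_le_four]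
  nlinarith

theorem ae_exists_stopsAt (hH : HasKernel H g)
    (hti : IsTranslationInvariant g) (hg : Continuous fun p : 𝒳 × 𝒳 => g p.1 p.2)
    (hN : 2 ≤ N) (hK : numClusters (trueClustering H ν) = K) (hδ0 : 0 < δ) (hδ1 : δ ≤ 1)
    (hX_meas : ∀ i s, Measurable (X i s)) (hX_law : ∀ i s, P.map (X i s) = (ν i : Measure 𝒳))
    (hX_indep : iIndepFun (fun p : Fin N × ℕ => X p.1 p.2) P) :
    ∀ᵐ ω ∂P, ∃ k, StopsAt g K δ (fun i s => X i s ω) k := by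
  have hle : ∀ k : ℕ, P.real {ω | ¬ ∃ k, StopsAt g K δ (fun i s => X i s ω) k} ≤
      δ / 8 * (1 / ((k : ℝ) + 1)) := fun k => by
    set l := max (k + 1) (kStar (snrSq g H ν)).toNat with hl
    have hl1 : k + 1 ≤ l := le_max_left _ _
    have hl2 : kStar (snrSq g H ν) ≤ l := (Int.self_le_toNat _).trans (by
      exact_mod_cast le_max_right (k + 1) _)
    have hl1' : 1 ≤ l := by omega
    have h1 : P.real {ω | ¬ ∃ k, StopsAt g K δ (fun i s => X i s ω) k} ≤
        P.real {ω | ¬ IsTypicalAt g H ν δ (fun i s => X i s ω) l} :=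
      measureReal_mono fun ω hω hx =>
        hω ⟨l, hx.stopsAt hH hti hg hN hK hδ0 hδ1 hl1' hl2⟩
    refine h1.trans ((measureReal_not_isTypicalAt_le hH hti hg hN hδ0 hδ1 hl1' hX_meas hX_law
      hX_indep).trans ?_)
    have h2 : (k : ℝ) + 1 ≤ l := by exact_mod_cast hl1
    have h3 : (1 : ℝ) ≤ l := by exact_mod_cast hl1'
    have h4 : (k : ℝ) + 1 ≤ (l : ℝ) ^ 2 := by nlinarith
    gcongr
  have hlim := tendsto_one_div_add_atTop_nhds_zero_nat (𝕜 := ℝ).const_mul (δ / 8)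
  have h0 := ge_of_tendsto' hlim hle
  rw [mul_zero] at h0
  exact ae_iff.2 ((measureReal_eq_zero_iff).1 (le_antisymm h0 measureReal_nonneg))

end Iterations

end KABC

end

/-! ### Guarantees for the algorithm -/

theorem theorem1
    {𝒳 : Type*} [AddGroup 𝒳] [TopologicalSpace 𝒳] [TopologicalSpace.SeparableSpace 𝒳]
    [MeasurableSpace 𝒳] [BorelSpace 𝒳]
    -- the kernel and its RKHS
    (g : 𝒳 → 𝒳 → ℝ)
    (H : Type*) [NormedAddCommGroup H] [InnerProductSpace ℝ H] [CompleteSpace H]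
    [RKHS ℝ H 𝒳 ℝ] (hH : KABC.HasKernel H g)
    (hg_cont : Continuous fun p : 𝒳 × 𝒳 => g p.1 p.2)
    (hg_pd : (Matrix.of g).PosSemidef)
    (hg_char : KABC.IsCharacteristic (𝒳 := 𝒳) H)
    (hg_ti : KABC.IsTranslationInvariant g)
    (hg_bdd : KABC.IsBoundedKernel g)
    -- the environment, with exactly `K` groups, and the confidence level
    (N : ℕ) (hN : 2 ≤ N) (ν : Fin N → ProbabilityMeasure 𝒳)
    (K : ℕ) (hK : KABC.numClusters (KABC.trueClustering H ν) = K)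
    (δ : ℝ) (hδ0 : 0 < δ) (hδ1 : δ ≤ 1)
    -- `X i s` is the outcome of the `s`-th pull of arm `i`
    {Ω : Type*} [MeasurableSpace Ω] (P : Measure Ω) [IsProbabilityMeasure P]
    (X : Fin N → ℕ → Ω → 𝒳) (hX_meas : ∀ i s, Measurable (X i s))
    (hX_law : ∀ i s, P.map (X i s) = (ν i : Measure 𝒳))
    (hX_indep : iIndepFun (fun p : Fin N × ℕ => X p.1 p.2) P) :
    -- correctness with probability at least `1 - δ`
    1 - δ ≤ P.real {ω | ∃ C : Setoid (Fin N),
        KABC.output g K δ (fun i s => X i s ω) = some C ∧ KABC.IsCorrect H ν C} ∧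
    -- almost sure termination
    (∀ᵐ ω ∂P, (∃ C : Setoid (Fin N), KABC.output g K δ (fun i s => X i s ω) = some C) ∧
        KABC.budget g K δ (fun i s => X i s ω) < ⊤) ∧
    -- the bound on the total number of samples
    1 - δ ≤ P.real {ω | ∃ τ : ℕ, KABC.budget g K δ (fun i s => X i s ω) = τ ∧
        (τ : ℝ) ≤ 8 * N * max (KABC.invSnr (KABC.snrSq g H ν)) 1 *
          Real.log (32 * ((N : ℝ) ^ 2 - N) *
            (KABC.kStar (KABC.snrSq g H ν) : ℝ) ^ 2 / δ)} := by
  have hterm := KABC.ae_exists_stopsAt hH hg_ti hg_cont hN hK hδ0 hδ1 hX_meas hX_law hX_indep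
  -- `k` is the iteration `k_*`
  obtain ⟨k, hk⟩ : ∃ k : ℕ, KABC.kStar (KABC.snrSq g H ν) = k :=
    Int.eq_ofNat_of_zero_le (zero_le_one.trans (le_max_right _ _))
  have hk1 : 1 ≤ k := by
    have : (1 : ℤ) ≤ k := hk ▸ le_max_right _ _
    exact_mod_cast this
  refine ⟨?_, ?_, ?_⟩
  · -- the algorithm stops at `k_*` at the latest if all iterations are typical
    refine KABC.one_sub_le_measureReal (KABC.measureReal_exists_not_isTypicalAt_le hH hg_ti
      hg_cont hN hδ0 hδ1 hX_meas hX_law hX_indep) fun ω hω => ?_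
    have hx : ∀ k, 1 ≤ k → KABC.IsTypicalAt g H ν δ (fun i s => X i s ω) k := fun k hk => by
      by_contra h
      exact hω ⟨k, hk, h⟩
    exact KABC.exists_output_isCorrect hH hg_ti hg_cont hN hK hδ0 hδ1 hx
      ⟨k, (hx k hk1).stopsAt hH hg_ti hg_cont hN hK hδ0 hδ1 hk1 hk.le⟩
  · filter_upwards [hterm] with ω ⟨l, hl⟩
    obtain ⟨τ, hτ, -⟩ := KABC.exists_budget_eq_of_stopsAt hl
    exact ⟨⟨_, dif_pos ⟨l, hl⟩⟩, hτ ▸ ENat.natCast_lt_top τ⟩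
  · have hp := KABC.measureReal_not_isTypicalAt_le hH hg_ti hg_cont hN hδ0 hδ1 hk1 hX_meas hX_law
      hX_indep
    have hp' : δ / 8 * (1 / (k : ℝ) ^ 2) ≤ δ := by
      have : 1 / (k : ℝ) ^ 2 ≤ 1 :=
        div_le_one_of_le₀ (one_le_pow₀ (by exact_mod_cast hk1)) (by positivity)
      nlinarith
    refine KABC.one_sub_le_measureReal (hp.trans hp') fun ω hω => ?_
    have hx : KABC.IsTypicalAt g H ν δ (fun i s => X i s ω) k := not_not.1 hω
    obtain ⟨τ, hτ, hle⟩ := KABC.exists_budget_eq_of_stopsAt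
      (hx.stopsAt hH hg_ti hg_cont hN hK hδ0 hδ1 hk1 hk.le)
    refine ⟨τ, hτ, (Nat.cast_le.2 hle).trans
      ((KABC.sum_perArmBudget_le hN hδ0 hδ1 hk1).trans ?_)⟩
    have hL := KABC.two_le_logTerm hN hδ0 hδ1 hk1
    rw [KABC.logTerm_confidence] at hL ⊢
    rw [hk, Int.cast_natCast]
    have h2 := KABC.two_pow_kStar_le hk
    calc _ ≤ 4 * (N : ℝ) * (2 * max (KABC.invSnr (KABC.snrSq g H ν)) 1) *
          Real.log (32 * ((N : ℝ) ^ 2 - N) * (k : ℝ) ^ 2 / δ) := by gcongr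
      _ = _ := by ring
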